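/- Let $K$ be a non-archimedean local field of positive characteristic $p$, with ring of integers $\mathfrak D=\{|x|\le 1\}$, maximal ideal $\mathfrak B$, uniformizer $\mathfrak p$ and residue field of $q=p^c$ elements. Let $dx$ be the Haar measure on $K$ with $\int_{\mathfrak D}dx=1$; "a.e." refers to it. Let $1=\epsilon_0,\epsilon_1,\dots,\epsilon_{c-1}$ be a $GF(p)$-basis of a subfield of $K$ with $q$ elements. For $0\le n<q$, $n=\sum_{k<c}a_kp^k$ with $0\le a_k<p$, put $u(n)=\big(\sum_{k<c}a_k\epsilon_k\big)\mathfrak p^{-1}$; for general $n=\sum_k b_kq^k$ with $0\le b_k<q$ put $u(n)=\sum_k\mathfrak p^{-k}u(b_k)$. Let $\chi$ be the continuous unitary character of $(K,+)$ that is trivial on $\mathfrak D$ and satisfies $\chi(\epsilon_0\mathfrak p^{-1})=e^{2\pi i/p}$ and $\chi(\epsilon_k\mathfrak p^{-j})=1$ if $k\ne0$ or $j\neq1$ ($j\in\mathbb Z$). Let $f\mapsto\hat f$ be the Fourier transform on $L^2(K)$, the continuous extension of $\hat f(\xi)=\int_K f(x)\overline{\chi(\xi x)}\,dx$ from $L^1(K)\cap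 L^2(K)$. Functions $\psi^1,\dots,\psi^L\in L^2(K)$ form a *multiwavelet* of order $L$ if $\{q^{j/2}\psi^l(\mathfrak p^{-j}\cdot-u(t)):1\le l\le L,\ j\in\mathbb Z,\ t\in\mathbb N_0\}$ is an orthonormal basis of $L^2(K)$. A set $W=W_1\cup\dots\cup W_L\subset K$, with measurable $W_l$, is a *multiwavelet set* of order $L$ if there is a multiwavelet $\psi^1,\dots,\psi^L$ with $\widehat{\psi^l}=\mathbf 1_{W_l}$ for all $l$. A *multiresolution analysis* (MRA) is a sequence $(V_j)_{j\in\mathbb Z}$ of closed subspaces of $L^2(K)$ such that $V_j\subset V_{j+1}$, $\overline{\bigcup_jV_j}=L^2(K)$, $\bigcap_jV_j=\{0\}$, $f\in V_j\iff f(\mathfrak p^{-1}\cdot)\in V_{j+1}$ for all $j$, and for some $\varphi\in V_0$ the family $\{\varphi(\cdot-u(t)):t\in\mathbb N_0\}$ is an orthonormal basis of $V_0$. The multiwavelet set *induces an MRA* if there are a multiwavelet $\psi^1,\dots,\psi^L$ with $\widehat{\psi^l}=\mathbf 1_{W_l}$ and an MRA $(V_j)$ such that $\{\psi^l(\cdot-u(t)):1\le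 l\le L,\ t\in\mathbb N_0\}$ is an orthonormal basis of the orthogonal complement of $V_0$ in $V_1$. **Theorem.** A multiwavelet set $W=W_1\cup\dots\cup W_{q-1}\subset K$ of order $q-1$ induces an MRA if and only if $$\bigcup_{m=1}^{q-1}\ \bigcup_{j=1}^{\infty}\ \bigcup_{t\in\mathbb N_0}\big(\mathfrak p^{j}W_m+u(t)\big)=K\quad\text{a.e.}$$ -/

import Mathlib

open MeasureTheory Filter Topology ValuativeRel
open scoped ENNReal ComplexConjugate

noncomputable section

namespace LocalFieldWavelet

section Field

variable {K : Type*} [Field K] [ValuativeRel K]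

/-- `ϖ` is an element of maximal valuation in the maximal ideal `{x | |x| < 1}`. -/
def IsUniformizer (ϖ : Kˣ) : Prop :=
  valuation K (ϖ : K) < 1 ∧
    ∀ x : K, valuation K x < 1 → valuation K x ≤ valuation K (ϖ : K)

/-- `ε_0 = 1, ε_1, …, ε_{c-1}` is a basis over the prime field `GF(p)` of a subfield of `K` with
`p ^ c` elements. In characteristic `p` the additive subgroup generated by the `ε_k` is their
`GF(p)`-span, and the cardinality forces the `ε_k` to be independent. -/
def IsCoefficientBasis (p c : ℕ) (ε : Fin c → K) : Prop :=
  (∀ k : Fin c, (k : ℕ) = 0 → ε k = 1) ∧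
    ∃ F : Subfield K, (F : Set K) = (AddSubgroup.closure (Set.range ε) : Set K) ∧
      Nat.card F = p ^ c

/-- `u(b) = (∑_k a_k ε_k) 𝔭⁻¹` for `b = ∑_{k < c} a_k p ^ k`, `0 ≤ a_k < p`. -/
def shiftDigit (p c : ℕ) (ϖ : Kˣ) (ε : Fin c → K) (b : ℕ) : K :=
  (∑ k : Fin c, ((b / p ^ (k : ℕ) % p : ℕ) : K) * ε k) * (ϖ : K)⁻¹

/-- `u(n) = ∑_k 𝔭^{-k} u(b_k)` for `n = ∑_k b_k q ^ k`, `0 ≤ b_k < q = p ^ c`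
(the base-`q` digits of `n` of index larger than `n` vanish). -/
def shift (p c : ℕ) (ϖ : Kˣ) (ε : Fin c → K) (n : ℕ) : K :=
  ∑ k ∈ Finset.range (n + 1),
    ((ϖ : K) ^ k)⁻¹ * shiftDigit p c ϖ ε (n / (p ^ c) ^ k % p ^ c)

/-- The character `χ` of `K⁺` that is continuous, unitary, trivial on the ring of integers, with
`χ(ε_0 𝔭⁻¹) = e^{2πi/p}` and `χ(ε_k 𝔭^{-j}) = 1` for all other pairs `(k, j)`. -/
def IsStandardCharacter [TopologicalSpace K] (p c : ℕ) (ϖ : Kˣ) (ε : Fin c → K)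
    (χ : AddChar K Circle) : Prop :=
  Continuous χ ∧ (∀ x : K, valuation K x ≤ 1 → χ x = 1) ∧
    ∀ (k : Fin c) (j : ℤ),
      χ (ε k * (ϖ : K) ^ (-j)) =
        if (k : ℕ) = 0 ∧ j = 1 then Circle.exp (2 * Real.pi / p) else 1

end Field

section Haar

variable {K : Type*} [Field K] [ValuativeRel K] [TopologicalSpace K]
  [IsNonarchimedeanLocalField K]

variable (K) in
/-- The ring of integers `{x | |x| ≤ 1}` as a compact set with non-empty interior. -/
def integerCompacts : TopologicalSpace.PositiveCompacts K where
  carrier := {x | valuation K x ≤ 1}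
  isCompact' := IsNonarchimedeanLocalField.isCompact_closedBall K 1
  interior_nonempty' := by
    refine ⟨0, mem_interior_iff_mem_nhds.2 ?_⟩
    rw [(IsValuativeTopology.hasBasis_nhds_zero' K).mem_iff]
    exact ⟨1, one_ne_zero, fun x hx => le_of_lt (show valuation K x < 1 from hx)⟩

variable [MeasurableSpace K] [BorelSpace K]

variable (K) in
/-- The Haar measure of `K⁺` that gives the ring of integers the measure `1`. -/
def haar : Measure K := Measure.addHaarMeasure (integerCompacts K)

instance : (haar K).IsAddHaarMeasure :=
  inferInstanceAs (Measure.addHaarMeasure (integerCompacts K)).IsAddHaarMeasure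

instance : (haar K).Regular :=
  inferInstanceAs (Measure.addHaarMeasure (integerCompacts K)).Regular

variable (K) in
/-- The Hilbert space `L²(K)`. -/
abbrev L2 : Type _ := Lp ℂ 2 (haar K)

theorem memLp_affine (a : Kˣ) (b : K) {f : K → ℂ} (hf : MemLp f 2 (haar K)) :
    MemLp (fun x => f ((a : K) * x - b)) 2 (haar K) := by
  have h1 : MemLp (fun x => f (x - b)) 2 (haar K) :=
    hf.comp_measurePreserving (measurePreserving_sub_right (haar K) b)
  let e : K ≃ₜ K := Homeomorph.mulLeft₀ (a : K) a.ne_zero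
  have hH : (Measure.map e (haar K)).IsAddHaarMeasure :=
    Measure.isAddHaarMeasure_map (haar K) (AddMonoidHom.mulLeft (a : K)) e.continuous
      e.surjective e.isClosedEmbedding.tendsto_cocompact
  have hR : (Measure.map e (haar K)).Regular := Measure.Regular.map e
  have h2 : MemLp (fun x => f (x - b)) 2 (Measure.map e (haar K)) := by
    rw [Measure.isAddLeftInvariant_eq_smul_of_regular (Measure.map e (haar K)) (haar K)]
    exact h1.smul_measure ENNReal.coe_ne_top
  exact h2.comp_of_map e.continuous.measurable.aemeasurable

/-- The function `x ↦ f (a x - b)` for `f ∈ L²(K)`. -/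
def affine (a : Kˣ) (b : K) (f : L2 K) : L2 K :=
  (memLp_affine a b (Lp.memLp f)).toLp

/-- `ψ_{j,t} = q^{j/2} ψ(𝔭^{-j} x - u(t))`. -/
def waveletElement (q : ℕ) (ϖ : Kˣ) (u : ℕ → K) (ψ : L2 K) (j : ℤ) (t : ℕ) : L2 K :=
  (((q : ℝ) ^ ((j : ℝ) / 2) : ℝ) : ℂ) • affine (ϖ ^ (-j)) (u t) ψ

/-- `(e i)` is an orthonormal basis of the closed subspace `V`. -/
def IsOrthonormalBasisOf {ι : Type*} (e : ι → L2 K) (V : Submodule ℂ (L2 K)) : Prop :=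
  Orthonormal ℂ e ∧ (Submodule.span ℂ (Set.range e)).topologicalClosure = V

/-- `ψ^1, …, ψ^L` is a multiwavelet: the affine system `{ψ^l_{j,t}}` is an orthonormal basis
of `L²(K)`. -/
def IsMultiwavelet (q : ℕ) (ϖ : Kˣ) (u : ℕ → K) {L : ℕ} (ψ : Fin L → L2 K) : Prop :=
  IsOrthonormalBasisOf
    (fun i : Fin L × ℤ × ℕ => waveletElement q ϖ u (ψ i.1) i.2.1 i.2.2) ⊤

/-- `g` is the Fourier transform of `f` in `L²(K)`: the pair `(f, g)` lies in the closure in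
`L²(K) × L²(K)` of the graph of `a ↦ (ξ ↦ ∫ a(x) conj (χ(ξ x)) dx)` on `L¹(K) ∩ L²(K)`. -/
def IsFourierTransform (χ : AddChar K Circle) (f g : L2 K) : Prop :=
  (f, g) ∈ closure {ab : L2 K × L2 K | Integrable ab.1 (haar K) ∧
    ab.2 =ᵐ[haar K] fun ξ => ∫ x, ab.1 x * conj ((χ (ξ * x) : Circle) : ℂ) ∂(haar K)}

/-- `f ∈ L²(K)` has Fourier transform the characteristic function of `S`. -/
def HasIndicatorTransform (χ : AddChar K Circle) (f : L2 K) (S : Set K) : Prop :=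
  ∃ g : L2 K, g =ᵐ[haar K] S.indicator 1 ∧ IsFourierTransform χ f g

/-- `W = W_1 ∪ … ∪ W_L` is a multiwavelet set of order `L`, with its pieces `W_l`. -/
def IsMultiwaveletSet (q : ℕ) (ϖ : Kˣ) (u : ℕ → K) (χ : AddChar K Circle) {L : ℕ}
    (W : Set K) (Wl : Fin L → Set K) : Prop :=
  W = ⋃ l, Wl l ∧ (∀ l, MeasurableSet (Wl l)) ∧
    ∃ ψ : Fin L → L2 K, (∀ l, HasIndicatorTransform χ (ψ l) (Wl l)) ∧ IsMultiwavelet q ϖ u ψ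

/-- A multiresolution analysis of `L²(K)`. -/
structure IsMRA (ϖ : Kˣ) (u : ℕ → K) (V : ℤ → Submodule ℂ (L2 K)) : Prop where
  isClosed : ∀ j, IsClosed (V j : Set (L2 K))
  nested : ∀ j, V j ≤ V (j + 1)
  dense : closure (⋃ j, (V j : Set (L2 K))) = Set.univ
  inter : ⋂ j, (V j : Set (L2 K)) = {0}
  dilation : ∀ (j : ℤ) (f : L2 K), f ∈ V j ↔ affine ϖ⁻¹ 0 f ∈ V (j + 1)
  scaling : ∃ φ ∈ V 0, IsOrthonormalBasisOf (fun t : ℕ => affine 1 (u t) φ) (V 0)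

/-- `ψ^1, …, ψ^L` comes from the multiresolution analysis `V`: the translates
`ψ^l(x - u(t))` form an orthonormal basis of the orthogonal complement of `V_0` in `V_1`. -/
def ComesFromMRA (u : ℕ → K) {L : ℕ} (ψ : Fin L → L2 K) (V : ℤ → Submodule ℂ (L2 K)) : Prop :=
  IsOrthonormalBasisOf (fun i : Fin L × ℕ => affine 1 (u i.2) (ψ i.1)) (V 1 ⊓ (V 0)ᗮ)

/-- The multiwavelet with Fourier transforms `1_{W_l}` comes from some multiresolution analysis. -/
def InducesMRA (q : ℕ) (ϖ : Kˣ) (u : ℕ → K) (χ : AddChar K Circle) {L : ℕ}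
    (Wl : Fin L → Set K) : Prop :=
  ∃ ψ : Fin L → L2 K, (∀ l, HasIndicatorTransform χ (ψ l) (Wl l)) ∧ IsMultiwavelet q ϖ u ψ ∧
    ∃ V : ℤ → Submodule ℂ (L2 K), IsMRA ϖ u V ∧ ComesFromMRA u ψ V

end Haar

end LocalFieldWavelet

end

open LocalFieldWavelet

/-! In characteristic `p` the parameters `u(n)` enumerate a countable additive subgroup Λ of `K`,
namely all ϖ⁻¹P(ϖ⁻¹) with P a polynomial over the coefficient field. Λ is a complement of the ring
of integers 𝔇 and χ(λμ) = 1 for λ, μ ∈ Λ (`exists_isDualLattice`). So the characters x ↦ χ(λx) are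
Λ-periodic, and they are orthonormal and complete on 𝔇. Consequently an integrable function on `K`
whose integrals against them vanish has vanishing sums over almost all cosets of Λ
(`IsDualLattice.ae_tsum_eq_zero`).

After Fourier transform ψ^l_{j,t} is a scalar times a character times the indicator of ϖ^{-j}W_l, so
orthonormality makes these dilates almost disjoint. Let S be the union of ϖ^j W_l over all l and j ≥
1. The criterion says that the Λ-translates of S cover `K`. Each W_l has measure 1 and
multiplication by ϖ divides measures by q, so q - 1 pieces give |S| ≤ (q - 1) ∑ q^{-j} = 1 = |𝔇|.

If the translates cover, this bound leaves no room for overlaps: S is a fundamental domain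
(`IsDualLattice.isAddFundamentalDomain_of_covers`) and the characters of Λ form an orthonormal basis
of L²(S). Hence the inverse transform of 1_S is a scaling function for V_0, the functions with
transform supported in S. The dilates of S give the other V_j, and the wavelet system, sorted by
scale, identifies the complement of V_0 in V_1.

Conversely, if some MRA induces the multiwavelet, V_0 is orthogonal to all wavelets of scale j ≥ 0,
hence lies in the closed span of those with j < 0, whose transforms live on S (`le_bandlimited`).
Orthonormality of the translates of φ gives ∑_λ |φ̂(ξ + λ)|² = 1 for almost every ξ, so some ξ + λ
lies in S (`covers_of_isMRA`). -/

noncomputable section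

namespace LocalFieldWavelet

/-! ### The translation lattice and its duality with the integers. -/

section Algebra

variable {K : Type*} [Field K] [ValuativeRel K]

theorem IsUniformizer.one_lt_inv {ϖ : Kˣ} (hϖ : IsUniformizer ϖ) :
    1 < valuation K ((ϖ : K)⁻¹) := by
  rw [map_inv₀]
  exact (one_lt_inv₀ (by simp [zero_lt_iff])).2 hϖ.1

theorem IsUniformizer.exists_eq_mul {ϖ : Kˣ} (hϖ : IsUniformizer ϖ) {x : K}
    (hx : valuation K x < 1) : ∃ y : K, valuation K y ≤ 1 ∧ x = ϖ * y := by
  refine ⟨(ϖ : K)⁻¹ * x, ?_, by simp⟩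
  rw [map_mul, map_inv₀]
  have h0 : valuation K (ϖ : K) ≠ 0 := by simp
  calc (valuation K (ϖ : K))⁻¹ * valuation K x
      ≤ (valuation K (ϖ : K))⁻¹ * valuation K (ϖ : K) := by gcongr; exact hϖ.2 x hx
    _ = 1 := inv_mul_cancel₀ h0

/-- Supplies an integer that multiplication by `x` sends to `ϖ⁻¹`, where χ is nontrivial. -/
theorem IsUniformizer.inv_mul_inv_le {ϖ : Kˣ} (hϖ : IsUniformizer ϖ) {x : K}
    (hx : 1 < valuation K x) : valuation K (x⁻¹ * (ϖ : K)⁻¹) ≤ 1 := by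
  have : valuation K x⁻¹ < 1 := by
    rw [map_inv₀]; exact inv_lt_one_of_one_lt₀ hx
  obtain ⟨y, hy, h⟩ := hϖ.exists_eq_mul this
  rw [h, mul_right_comm]
  simpa using hy

/-- `Λ` is a discrete complement of the ring of integers that is its own annihilator for the
pairing `(x, y) ↦ χ (x y)`, where `χ` is trivial on the integers but not on `ϖ⁻¹`. -/
structure IsDualLattice [TopologicalSpace K] (ϖ : Kˣ) (χ : AddChar K Circle)
    (Λ : AddSubgroup K) : Prop where
  uniformizer : IsUniformizer ϖ
  continuous : Continuous χ
  countable : (Λ : Set K).Countable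
  exists_sub_mem : ∀ x : K, ∃ y ∈ Λ, valuation K (x - y) ≤ 1
  eq_zero : ∀ x ∈ Λ, valuation K x ≤ 1 → x = 0
  char_integer : ∀ x : K, valuation K x ≤ 1 → χ x = 1
  char_mul : ∀ x ∈ Λ, ∀ y ∈ Λ, χ (x * y) = 1
  char_inv : χ ((ϖ : K)⁻¹) ≠ 1

/-! ### The coefficient field and polynomials in ϖ⁻¹ over it. -/

section FiniteSubfield

variable {F : Subfield K}

/-- Nonzero elements of a finite field are roots of unity, and a linearly ordered value group has no
torsion. -/
theorem valuation_eq_one_of_mem_subfield [Finite F] {a : K} (ha : a ∈ F) (h0 : a ≠ 0) :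
    valuation K a = 1 := by
  have := Fintype.ofFinite F
  have h : (⟨a, ha⟩ : F) ^ (Fintype.card F - 1) = 1 :=
    FiniteField.pow_card_sub_one_eq_one _ (by simpa [Subtype.ext_iff] using h0)
  have h' : a ^ (Fintype.card F - 1) = 1 := by simpa [Subtype.ext_iff] using h
  have hc : Fintype.card F - 1 ≠ 0 := by have := Fintype.one_lt_card (α := F); omega
  have := congrArg (valuation K) h'
  rw [map_pow, map_one] at this
  exact (pow_eq_one_iff.1 this).resolve_right hc

theorem valuation_le_one_of_mem_subfield [Finite F] {a : K} (ha : a ∈ F) :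
    valuation K a ≤ 1 := by
  rcases eq_or_ne a 0 with rfl | h
  · simp
  · exact (valuation_eq_one_of_mem_subfield ha h).le

/-- A subfield with as many elements as the residue field represents all residue classes. -/
theorem exists_mem_subfield_sub_lt [Finite F] (hF : Nat.card F = Nat.card 𝓀[K]) {x : K}
    (hx : valuation K x ≤ 1) : ∃ a ∈ F, valuation K (x - a) < 1 := by
  let i : F →+* 𝒪[K] := F.subtype.codRestrict (valuation K).integer
    fun a => valuation_le_one_of_mem_subfield a.2
  let r : F →+* 𝓀[K] := (IsLocalRing.residue 𝒪[K]).comp i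
  have hfin : Finite 𝓀[K] := Nat.finite_of_card_ne_zero (hF ▸ Nat.card_pos.ne')
  -- A ring homomorphism between fields is injective; equal finite cardinalities make it bijective.
  have hr : Function.Bijective r :=
    (Nat.bijective_iff_injective_and_card r).2 ⟨r.injective, hF⟩
  obtain ⟨a, ha⟩ := hr.2 (IsLocalRing.residue 𝒪[K] ⟨x, hx⟩)
  refine ⟨a, a.2, ?_⟩
  have h : IsLocalRing.residue 𝒪[K] (⟨x, hx⟩ - i a) = 0 := by
    rw [map_sub, ← ha]; exact sub_self _
  rw [IsLocalRing.residue_eq_zero_iff, IsLocalRing.mem_maximalIdeal, mem_nonunits_iff,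
    Valuation.Integer.not_isUnit_iff_valuation_lt_one] at h
  exact h

/-- The evaluation `P ↦ P(ϖ⁻¹)` of polynomials over `F`. -/
def evalInv (F : Subfield K) (ϖ : Kˣ) : Polynomial F →+* K :=
  Polynomial.eval₂RingHom F.subtype (ϖ : K)⁻¹

/-- The leading term dominates, as |ϖ⁻¹| > 1 and nonzero coefficients have valuation 1. The Horner
induction also carries a strict bound for zero constant term, so that adding a nonzero constant
leaves the valuation unchanged. -/
theorem one_le_valuation_evalInv [Finite F] {ϖ : Kˣ} (hϖ : IsUniformizer ϖ) {P : Polynomial F}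
    (hP : P ≠ 0) : 1 ≤ valuation K (evalInv F ϖ P) := by
  suffices h : (P ≠ 0 → 1 ≤ valuation K (evalInv F ϖ P)) ∧
      (P ≠ 0 → P.coeff 0 = 0 → 1 < valuation K (evalInv F ϖ P)) from h.1 hP
  induction P using Polynomial.recOnHorner with
  | M0 => simp
  | MC P a h0 ha ih =>
    refine ⟨fun _ => ?_, fun _ h => absurd h (by simp [h0, ha])⟩
    have hva : valuation K (evalInv F ϖ (Polynomial.C a)) = 1 := by
      simpa [evalInv] using
        valuation_eq_one_of_mem_subfield a.2 fun h => ha (Subtype.ext h)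
    rcases eq_or_ne P 0 with rfl | hne
    · simp [hva]
    · have h1 := ih hne |>.2 hne h0
      rw [map_add, Valuation.map_add_eq_of_lt_left _ (by rw [hva]; exact h1)]
      exact h1.le
  | MX P hne ih =>
    have h1 := (ih hne).1 hne
    have h2 : 1 < valuation K (evalInv F ϖ (P * Polynomial.X)) := by
      rw [map_mul, map_mul]
      have : evalInv F ϖ Polynomial.X = (ϖ : K)⁻¹ := by simp [evalInv]
      rw [this]
      exact one_lt_mul_of_le_of_lt h1 hϖ.one_lt_inv
    exact ⟨fun _ => h2.le, fun _ _ => h2⟩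

/-- The additive map `P ↦ ϖ⁻¹ P(ϖ⁻¹)` of polynomials over `F`. -/
def polarHom (F : Subfield K) (ϖ : Kˣ) : Polynomial F →+ K :=
  (AddMonoidHom.mulLeft ((ϖ : K)⁻¹)).comp (evalInv F ϖ).toAddMonoidHom

theorem polarHom_apply (ϖ : Kˣ) (P : Polynomial F) :
    polarHom F ϖ P = (ϖ : K)⁻¹ * evalInv F ϖ P := rfl

/-- The extra factor `ϖ⁻¹` makes the bound strict; this yields both injectivity and Λ ∩ 𝔇 = 0. -/
theorem one_lt_valuation_polarHom [Finite F] {ϖ : Kˣ} (hϖ : IsUniformizer ϖ)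
    {P : Polynomial F} (hP : P ≠ 0) : 1 < valuation K (polarHom F ϖ P) := by
  rw [polarHom_apply, map_mul]
  exact one_lt_mul_of_lt_of_le hϖ.one_lt_inv (one_le_valuation_evalInv hϖ hP)

theorem polarHom_injective [Finite F] {ϖ : Kˣ} (hϖ : IsUniformizer ϖ) :
    Function.Injective (polarHom F ϖ) := by
  refine (injective_iff_map_eq_zero _).2 fun P h => ?_
  by_contra hP
  have := one_lt_valuation_polarHom hϖ hP
  rw [h, map_zero] at this
  exact absurd this (by simp)

/-- Strips the polar part of `x` digit by digit: if `a` represents the residue class of `ϖ ^ (N + 1)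
* x`, then x - aϖ^{-(N+1)} becomes integral after multiplication by `ϖ ^ N`. -/
theorem exists_polarHom_sub_le [Finite F] (hF : Nat.card F = Nat.card 𝓀[K]) {ϖ : Kˣ}
    (hϖ : IsUniformizer ϖ) (N : ℕ) (x : K) (hx : valuation K ((ϖ : K) ^ N * x) ≤ 1) :
    ∃ P, valuation K (x - polarHom F ϖ P) ≤ 1 := by
  induction N generalizing x with
  | zero => exact ⟨0, by simpa using hx⟩
  | succ N ih =>
    obtain ⟨a, ha, hlt⟩ := exists_mem_subfield_sub_lt hF hx
    obtain ⟨y, hy, h⟩ := hϖ.exists_eq_mul hlt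
    have hpow : (ϖ : K) ^ N ≠ 0 := pow_ne_zero _ ϖ.ne_zero
    obtain ⟨P, hP⟩ := ih (((ϖ : K) ^ N)⁻¹ * y) (by rwa [mul_inv_cancel_left₀ hpow])
    refine ⟨P + Polynomial.monomial N ⟨a, ha⟩, ?_⟩
    have hm : polarHom F ϖ (Polynomial.monomial N ⟨a, ha⟩)
        = (ϖ : K)⁻¹ * (a * ((ϖ : K)⁻¹) ^ N) := by
      simp [polarHom_apply, evalInv]
    have hxe : x = ((ϖ : K) ^ N)⁻¹ * y + (ϖ : K)⁻¹ * (a * ((ϖ : K)⁻¹) ^ N) := by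
      have h0 := ϖ.ne_zero
      rw [pow_succ] at h
      rw [inv_pow]
      field_simp
      linear_combination h
    rw [map_add, hm]
    convert hP using 2
    rw [hxe]; ring

end FiniteSubfield

theorem IsUniformizer.exists_pow_mul_le [MulArchimedean (ValueGroupWithZero K)] {ϖ : Kˣ}
    (hϖ : IsUniformizer ϖ) (x : K) : ∃ N : ℕ, valuation K ((ϖ : K) ^ N * x) ≤ 1 := by
  obtain ⟨N, hN⟩ := MulArchimedean.arch (valuation K x) hϖ.one_lt_inv
  refine ⟨N, ?_⟩
  rw [map_mul, map_pow]
  rw [map_inv₀] at hN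
  have h0 : valuation K (ϖ : K) ≠ 0 := by simp
  calc valuation K (ϖ : K) ^ N * valuation K x
      ≤ valuation K (ϖ : K) ^ N * (valuation K (ϖ : K))⁻¹ ^ N := by gcongr
    _ = 1 := by rw [← mul_pow, mul_inv_cancel₀ h0, one_pow]

/-! ### Base-`p` and base-`q` digits. -/

section Digits

variable {p c : ℕ} {ε : Fin c → K} {F : Subfield K}

/-- The combination `∑ a_k ε_k` with coefficients the base-`p` digits of `b`. -/
def digitSum (p c : ℕ) (ε : Fin c → K) (b : ℕ) : K :=
  ∑ k : Fin c, ((b / p ^ (k : ℕ) % p : ℕ) : K) * ε k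

theorem digitSum_zero : digitSum p c ε 0 = 0 := by simp [digitSum]

theorem digitSum_mem (hF : (F : Set K) = (AddSubgroup.closure (Set.range ε) : Set K)) (b : ℕ) :
    digitSum p c ε b ∈ F := by
  refine sum_mem fun k _ => mul_mem (natCast_mem F _) ?_
  have : ε k ∈ (F : Set K) := hF ▸ AddSubgroup.subset_closure ⟨k, rfl⟩
  exact this

/-- In characteristic `p` integer coefficients matter only modulo `p`, so they can be taken to be
the base-`p` digits of a single `b`. -/
theorem exists_digitSum_eq [NeZero p] [CharP K p]
    (hF : (F : Set K) = (AddSubgroup.closure (Set.range ε) : Set K)) {a : K} (ha : a ∈ F) :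
    ∃ b < p ^ c, digitSum p c ε b = a := by
  have ha' : a ∈ AddSubgroup.closure (Set.range ε) := by
    rw [← SetLike.mem_coe, ← hF]; exact ha
  suffices h : ∃ n : Fin c → ℤ, ∑ k, (n k : K) * ε k = a by
    obtain ⟨n, hn⟩ := h
    have hp : (0 : ℤ) < p := by exact_mod_cast NeZero.pos p
    have hr : ∀ k, 0 ≤ n k % p := fun k => Int.emod_nonneg _ hp.ne'
    let d : Fin c → Fin p := fun k =>
      ⟨(n k % p).toNat, by have := Int.emod_lt_of_pos (n k) hp; have := hr k; omega⟩
    refine ⟨finFunctionFinEquiv d, Fin.is_lt _, ?_⟩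
    rw [← hn, digitSum]
    refine Finset.sum_congr rfl fun k _ => ?_
    congr 1
    have h1 : (finFunctionFinEquiv d : ℕ) / p ^ (k : ℕ) % p = d k := by
      conv_rhs => rw [← finFunctionFinEquiv.symm_apply_apply d]
      rfl
    rw [h1]
    have h2 : ((d k : ℕ) : ℤ) = n k % p := Int.toNat_of_nonneg (hr k)
    have h3 : ((d k : ℕ) : K) = ((n k % p : ℤ) : K) := by rw [← h2]; simp
    rw [h3]
    exact (CharP.intCast_eq_intCast_mod K p).symm
  induction ha' using AddSubgroup.closure_induction with
  | mem x hx =>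
    obtain ⟨k, rfl⟩ := hx
    exact ⟨Pi.single k 1, by simp [Pi.single_apply, ite_mul, apply_ite]⟩
  | zero => exact ⟨0, by simp⟩
  | add x y hx hy ihx ihy =>
    obtain ⟨n, hn⟩ := ihx (by rw [← SetLike.mem_coe, hF]; exact hx)
    obtain ⟨m, hm⟩ := ihy (by rw [← SetLike.mem_coe, hF]; exact hy)
    exact ⟨n + m, by simp [add_mul, Finset.sum_add_distrib, hn, hm]⟩
  | neg x hx ihx =>
    obtain ⟨n, hn⟩ := ihx (by rw [← SetLike.mem_coe, hF]; exact hx)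
    exact ⟨-n, by simp [hn]⟩

/-- A surjection between finite sets of the same size `p ^ c` is injective; this replaces an appeal
to linear independence of the `ε k`. -/
theorem digitSum_injOn [NeZero p] [CharP K p]
    (hF : (F : Set K) = (AddSubgroup.closure (Set.range ε) : Set K))
    (hc : Nat.card F = p ^ c) {a b : ℕ} (ha : a < p ^ c) (hb : b < p ^ c)
    (h : digitSum p c ε a = digitSum p c ε b) : a = b := by
  let f : Fin (p ^ c) → F := fun b => ⟨digitSum p c ε b, digitSum_mem hF b⟩
  have hs : Function.Surjective f := fun x => by
    obtain ⟨b, hb, h⟩ := exists_digitSum_eq (p := p) hF x.2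
    exact ⟨⟨b, hb⟩, Subtype.ext h⟩
  have hf : Function.Bijective f :=
    (Nat.bijective_iff_surjective_and_card f).2 ⟨hs, by simp [hc]⟩
  have := hf.1 (a₁ := ⟨a, ha⟩) (a₂ := ⟨b, hb⟩) (Subtype.ext h)
  simpa using this

/-- The polynomial over `F` whose coefficients are given by the base-`q` digits of `n`. -/
def digitPolynomial {q : ℕ} (d : ℕ → F) (n : ℕ) : Polynomial F :=
  ∑ k ∈ Finset.range (n + 1), Polynomial.monomial k (d (n / q ^ k % q))

theorem coeff_digitPolynomial {q : ℕ} (hq : 1 < q) {d : ℕ → F} (hd : d 0 = 0) (n k : ℕ) :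
    (digitPolynomial (q := q) d n).coeff k = d (n / q ^ k % q) := by
  simp only [digitPolynomial, Polynomial.finsetSum_coeff, Polynomial.coeff_monomial]
  rw [Finset.sum_ite_eq' (Finset.range (n + 1)) k fun k => d (n / q ^ k % q)]
  split_ifs with h
  · rfl
  · have h' : n < k := by simpa using h
    rw [Nat.div_eq_of_lt (h'.trans (Nat.lt_pow_self hq)), Nat.zero_mod, hd]

theorem digitPolynomial_injective {q : ℕ} (hq : 1 < q) {d : ℕ → F} (hd : d 0 = 0)
    (hinj : ∀ a < q, ∀ b < q, d a = d b → a = b) :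
    Function.Injective (digitPolynomial (q := q) d) := by
  intro n m h
  have hpos : 0 < q := by omega
  have hdig : ∀ k, n / q ^ k % q = m / q ^ k % q := fun k => by
    have := congrArg (fun P => Polynomial.coeff P k) h
    simp only [coeff_digitPolynomial hq hd] at this
    exact hinj _ (Nat.mod_lt _ hpos) _ (Nat.mod_lt _ hpos) this
  have hn : n < q ^ (n + m) :=
    (Nat.lt_pow_self hq).trans_le (Nat.pow_le_pow_right hpos (by omega))
  have hm : m < q ^ (n + m) :=
    (Nat.lt_pow_self hq).trans_le (Nat.pow_le_pow_right hpos (by omega))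
  have : (finFunctionFinEquiv.symm ⟨n, hn⟩ : Fin (n + m) → Fin q)
      = finFunctionFinEquiv.symm ⟨m, hm⟩ := by
    funext k
    exact Fin.ext (hdig k)
  simpa using finFunctionFinEquiv.symm.injective this

theorem digitPolynomial_surjective {q : ℕ} (hq : 1 < q) {d : ℕ → F} (hd : d 0 = 0)
    (hsurj : ∀ a, ∃ b < q, d b = a) : Function.Surjective (digitPolynomial (q := q) d) := by
  intro P
  have hsurj' : ∀ a, ∃ b : Fin q, d b = a := fun a => by
    obtain ⟨b, hb, h⟩ := hsurj a
    exact ⟨⟨b, hb⟩, h⟩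
  choose e he using hsurj'
  let N := P.natDegree + 1
  let g : Fin N → Fin q := fun k => e (P.coeff k)
  refine ⟨finFunctionFinEquiv g, Polynomial.ext fun k => ?_⟩
  rw [coeff_digitPolynomial hq hd]
  by_cases hk : k < N
  · have h1 : (finFunctionFinEquiv g : ℕ) / q ^ k % q = g ⟨k, hk⟩ := by
      conv_rhs => rw [← finFunctionFinEquiv.symm_apply_apply g]
      rfl
    rw [h1, he]
  · have hlt : (finFunctionFinEquiv g : ℕ) < q ^ k :=
      (Fin.is_lt _).trans_le (Nat.pow_le_pow_right (by omega) (by omega))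
    rw [Nat.div_eq_of_lt hlt, Nat.zero_mod, hd, Polynomial.coeff_eq_zero_of_natDegree_lt]
    omega

/-- Although `shift` is not additive in `n`, this exhibits its values as values of an additive map,
so that its range is a subgroup. -/
theorem shift_eq_polarHom (hF : (F : Set K) = (AddSubgroup.closure (Set.range ε) : Set K))
    (ϖ : Kˣ) (n : ℕ) : shift p c ϖ ε n = polarHom F ϖ (digitPolynomial (q := p ^ c)
      (fun b => ⟨digitSum p c ε b, digitSum_mem hF b⟩) n) := by
  simp only [shift, digitPolynomial, polarHom_apply, map_sum, Finset.mul_sum]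
  refine Finset.sum_congr rfl fun k _ => ?_
  simp only [evalInv, Polynomial.coe_eval₂RingHom, Polynomial.eval₂_monomial,
    Subfield.subtype_apply, shiftDigit, digitSum]
  rw [inv_pow]; ring

end Digits

/-! ### Values of the standard character on products of lattice elements. -/

section Standard

variable {p c : ℕ} {ε : Fin c → K} {F : Subfield K} [TopologicalSpace K]

/-- The product is ϖ⁻²R(ϖ⁻¹) for a polynomial R, so only powers ϖ^{-j} with j ≥ 2 occur, while χ is
nontrivial only at j = 1. -/
theorem IsStandardCharacter.map_polarHom_mul {ϖ : Kˣ} {χ : AddChar K Circle}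
    (hχ : IsStandardCharacter p c ϖ ε χ)
    (hF : (F : Set K) = (AddSubgroup.closure (Set.range ε) : Set K)) (P Q : Polynomial F) :
    χ (polarHom F ϖ P * polarHom F ϖ Q) = 1 := by
  have h : ∀ R : Polynomial F, χ ((ϖ : K)⁻¹ * (ϖ : K)⁻¹ * evalInv F ϖ R) = 1 := by
    intro R
    induction R using Polynomial.induction_on' with
    | add P Q hP hQ => rw [map_add, mul_add, AddChar.map_add_eq_mul, hP, hQ, one_mul]
    | monomial n a =>
      have ha : (a : K) ∈ AddSubgroup.closure (Set.range ε) := by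
        rw [← SetLike.mem_coe, ← hF]; exact a.2
      have key : ∀ x ∈ AddSubgroup.closure (Set.range ε),
          χ (x * (ϖ : K) ^ (-((n : ℤ) + 2))) = 1 := by
        intro x hx
        induction hx using AddSubgroup.closure_induction with
        | mem x hx =>
          obtain ⟨k, rfl⟩ := hx
          rw [hχ.2.2 k (n + 2), if_neg]
          omega
        | zero => simp
        | add x y _ _ hx hy => rw [add_mul, AddChar.map_add_eq_mul, hx, hy, one_mul]
        | neg x _ hx => rw [neg_mul, AddChar.map_neg_eq_inv, hx, inv_one]
      convert key a ha using 2
      simp only [evalInv, Polynomial.coe_eval₂RingHom, Polynomial.eval₂_monomial,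
        Subfield.subtype_apply]
      rw [zpow_neg, zpow_add₀ ϖ.ne_zero]
      simp only [zpow_natCast, mul_inv, inv_pow]
      rw [show (ϖ : K) ^ (2 : ℤ) = ϖ * ϖ by rw [zpow_ofNat, sq], mul_inv]
      ring
  rw [← h (P * Q), polarHom_apply, polarHom_apply, (evalInv F ϖ).map_mul]
  congr 1; ring

theorem circle_exp_two_pi_div_ne_one {p : ℕ} (hp : 1 < p) :
    Circle.exp (2 * Real.pi / p) ≠ 1 := by
  intro h
  have hp0 : (0 : ℝ) < p := by positivity
  obtain ⟨n, hn⟩ := Circle.exp_eq_one.1 h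
  have h1 : (1 : ℝ) = n * p := by
    have := Real.pi_pos
    field_simp at hn
    linarith
  have h2 : (1 : ℤ) = n * p := by exact_mod_cast h1
  have h3 : (p : ℤ) ∣ 1 := ⟨n, by rw [h2]; ring⟩
  have := Int.le_of_dvd one_pos h3
  omega

end Standard

end Algebra

section

variable {K : Type*} [Field K] [ValuativeRel K] [TopologicalSpace K]
  [IsNonarchimedeanLocalField K] {p c : ℕ} {ϖ : Kˣ} {ε : Fin c → K} {χ : AddChar K Circle}

theorem one_lt_of_card_residueField (hq : Nat.card 𝓀[K] = p ^ c) : 1 < p ^ c := by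
  rw [← hq]; exact Finite.one_lt_card

/-- The translation parameters `u(n)` are pairwise distinct and enumerate a dual lattice. -/
theorem exists_isDualLattice [Fact p.Prime] [CharP K p] (hq : Nat.card 𝓀[K] = p ^ c)
    (hϖ : IsUniformizer ϖ) (hε : IsCoefficientBasis p c ε)
    (hχ : IsStandardCharacter p c ϖ ε χ) :
    Function.Injective (shift p c ϖ ε) ∧
      ∃ Λ : AddSubgroup K, (Λ : Set K) = Set.range (shift p c ϖ ε) ∧ IsDualLattice ϖ χ Λ := by
  obtain ⟨hε0, F, hF, hcard⟩ := hε
  have hq1 := one_lt_of_card_residueField hq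
  have : NeZero p := ⟨(Fact.out : p.Prime).ne_zero⟩
  have : Finite F := Nat.finite_of_card_ne_zero (by rw [hcard]; omega)
  -- Provides the index of ε_0 = 1, at which χ(ϖ⁻¹) ≠ 1 is read off.
  have hc : 0 < c := by
    rcases Nat.eq_zero_or_pos c with rfl | h
    · simp at hq1
    · exact h
  let d : ℕ → F := fun b => ⟨digitSum p c ε b, digitSum_mem hF b⟩
  have hd : d 0 = 0 := Subtype.ext digitSum_zero
  have hdi : ∀ a < p ^ c, ∀ b < p ^ c, d a = d b → a = b := fun a ha b hb h =>
    digitSum_injOn hF hcard ha hb (Subtype.ext_iff.1 h)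
  have hds : ∀ a, ∃ b < p ^ c, d b = a := fun a => by
    obtain ⟨b, hb, h⟩ := exists_digitSum_eq (p := p) hF a.2
    exact ⟨b, hb, Subtype.ext h⟩
  have hu : shift p c ϖ ε = polarHom F ϖ ∘ digitPolynomial (q := p ^ c) d :=
    funext fun n => shift_eq_polarHom hF ϖ n
  have hrange : ((polarHom F ϖ).range : Set K) = Set.range (shift p c ϖ ε) := by
    rw [hu, (digitPolynomial_surjective hq1 hd hds).range_comp]
    rfl
  refine ⟨?_, (polarHom F ϖ).range, hrange, hϖ, hχ.1, ?_, ?_, ?_, hχ.2.1, ?_, ?_⟩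
  · rw [hu]
    exact (polarHom_injective hϖ).comp (digitPolynomial_injective hq1 hd hdi)
  · rw [hrange]; exact Set.countable_range _
  · intro x
    obtain ⟨N, hN⟩ := hϖ.exists_pow_mul_le x
    obtain ⟨P, hP⟩ := exists_polarHom_sub_le (hcard.trans hq.symm) hϖ N x hN
    exact ⟨_, ⟨P, rfl⟩, hP⟩
  · rintro _ ⟨P, rfl⟩ h
    by_contra hne
    exact absurd (one_lt_valuation_polarHom hϖ (fun h0 => hne (by rw [h0, map_zero]))) h.not_gt
  · rintro _ ⟨P, rfl⟩ _ ⟨Q, rfl⟩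
    exact hχ.map_polarHom_mul hF P Q
  · have h := hχ.2.2 ⟨0, hc⟩ 1
    rw [if_pos ⟨rfl, rfl⟩, hε0 ⟨0, hc⟩ rfl, one_mul, zpow_neg_one] at h
    rw [h]
    exact circle_exp_two_pi_div_ne_one (Fact.out : p.Prime).one_lt

end

end LocalFieldWavelet

end

noncomputable section

namespace LocalFieldWavelet

/-! ### Clopen balls and second countability. -/

section Topology

variable {K : Type*} [Field K] [ValuativeRel K]

variable (K) in
/-- The ring of integers `{x | |x| ≤ 1}` as a set. -/
def integerBall : Set K := {x | valuation K x ≤ 1}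

theorem mem_integerBall {x : K} : x ∈ integerBall K ↔ valuation K x ≤ 1 := Iff.rfl

theorem neg_mem_integerBall {x : K} : -x ∈ integerBall K ↔ x ∈ integerBall K := by
  simp [mem_integerBall]

theorem add_mem_integerBall {x y : K} (hx : x ∈ integerBall K) (hy : y ∈ integerBall K) :
    x + y ∈ integerBall K :=
  (valuation K).integer.add_mem hx hy

theorem add_mem_integerBall_iff {x y : K} (hx : x ∈ integerBall K) :
    x + y ∈ integerBall K ↔ y ∈ integerBall K :=
  (valuation K).integer.toAddSubgroup.add_mem_cancel_left hx

theorem mul_mem_integerBall {x y : K} (hx : x ∈ integerBall K) (hy : y ∈ integerBall K) :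
    x * y ∈ integerBall K :=
  (valuation K).integer.mul_mem hx hy

variable [TopologicalSpace K] [IsNonarchimedeanLocalField K]

theorem isClopen_integerBall : IsClopen (integerBall K) := by
  letI := IsTopologicalAddGroup.rightUniformSpace K
  have := isUniformAddGroup_of_addCommGroup (G := K)
  exact Valued.isClopen_integer K

theorem isCompact_integerBall : IsCompact (integerBall K) :=
  IsNonarchimedeanLocalField.isCompact_closedBall K 1

variable {ϖ : Kˣ} {χ : AddChar K Circle} {Λ : AddSubgroup K}

/-- The ball `ϖ ^ k (x + 𝔇)`. -/
def scaledBall (ϖ : Kˣ) (k : ℕ) (x : K) : Set K :=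
  {y | ((ϖ : K) ^ k)⁻¹ * y - x ∈ integerBall K}

theorem isClopen_scaledBall (k : ℕ) (x : K) : IsClopen (scaledBall ϖ k x) :=
  isClopen_integerBall.preimage (by fun_prop)

/-- Centres in Λ suffice because Λ meets every coset of 𝔇. Countability of Λ then gives second
countability, needed for generating the Borel sets by clopen sets and for Fubini. -/
theorem IsDualLattice.isTopologicalBasis_scaledBall (hΛ : IsDualLattice ϖ χ Λ) :
    TopologicalSpace.IsTopologicalBasis {s | ∃ k : ℕ, ∃ x ∈ Λ, s = scaledBall ϖ k x} := by
  refine TopologicalSpace.isTopologicalBasis_of_isOpen_of_nhds ?_ ?_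
  · rintro _ ⟨k, x, -, rfl⟩
    exact (isClopen_scaledBall k x).isOpen
  · intro a u ha hu
    have h0 : (a + ·) ⁻¹' u ∈ 𝓝 (0 : K) :=
      (continuous_const_add a).continuousAt.preimage_mem_nhds
        (by simpa using hu.mem_nhds ha)
    obtain ⟨γ, hγ, hs⟩ := (IsValuativeTopology.hasBasis_nhds_zero' K).mem_iff.1 h0
    obtain ⟨z, rfl⟩ := ValuativeRel.valuation_surjective γ
    have hz : z ≠ 0 := by simpa using hγ
    -- The radius uses `N + 1` instead of `N` to make the final inequality strict.
    obtain ⟨N, hN⟩ := hΛ.uniformizer.exists_pow_mul_le z⁻¹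
    obtain ⟨x, hx, hax⟩ := hΛ.exists_sub_mem (((ϖ : K) ^ (N + 1))⁻¹ * a)
    refine ⟨_, ⟨N + 1, x, hx, rfl⟩, hax, fun y hy => ?_⟩
    have hp : (ϖ : K) ^ (N + 1) ≠ 0 := pow_ne_zero _ ϖ.ne_zero
    have h1 : ((ϖ : K) ^ (N + 1))⁻¹ * (y - a) ∈ integerBall K := by
      have := add_mem_integerBall hy (neg_mem_integerBall.2 hax)
      convert this using 1; ring
    have h2 : valuation K (y - a) < valuation K z := by
      have e : y - a = ϖ * (((ϖ : K) ^ N * z⁻¹) * (((ϖ : K) ^ (N + 1))⁻¹ * (y - a))) * z := by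
        rw [pow_succ]
        have := ϖ.ne_zero
        field_simp
      have h3 : valuation K (((ϖ : K) ^ N * z⁻¹) * (((ϖ : K) ^ (N + 1))⁻¹ * (y - a))) ≤ 1 :=
        mul_mem_integerBall hN h1
      rw [e, (valuation K).map_mul, (valuation K).map_mul]
      have hz' : 0 < valuation K z := by simpa [zero_lt_iff] using hz
      calc _ ≤ valuation K (ϖ : K) * 1 * valuation K z := by gcongr
        _ < 1 * valuation K z := by
          rw [mul_one]; exact mul_lt_mul_of_pos_right hΛ.uniformizer.1 hz'
        _ = _ := one_mul _
    have h3 := hs (show y - a ∈ {x | valuation K x < valuation K z} from h2)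
    simpa using h3

theorem IsDualLattice.secondCountableTopology (hΛ : IsDualLattice ϖ χ Λ) :
    SecondCountableTopology K := by
  refine hΛ.isTopologicalBasis_scaledBall.secondCountableTopology ?_
  have : {s | ∃ k : ℕ, ∃ x ∈ Λ, s = scaledBall ϖ k x}
      = ⋃ k : ℕ, (scaledBall ϖ k) '' (Λ : Set K) := by
    ext s; simp [eq_comm]
  rw [this]
  exact Set.countable_iUnion fun k => hΛ.countable.image _

theorem IsDualLattice.isTopologicalBasis_isClopen (hΛ : IsDualLattice ϖ χ Λ) :
    TopologicalSpace.IsTopologicalBasis {s : Set K | IsClopen s} :=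
  hΛ.isTopologicalBasis_scaledBall.of_isOpen_of_subset (fun _ hs => IsClopen.isOpen hs) (by
    rintro _ ⟨k, x, -, rfl⟩
    exact isClopen_scaledBall k x)

variable [MeasurableSpace K] [BorelSpace K]

theorem measurableSet_integerBall : MeasurableSet (integerBall K) :=
  isClopen_integerBall.isOpen.measurableSet

theorem haar_integerBall : haar K (integerBall K) = 1 :=
  Measure.addHaarMeasure_self (K₀ := integerCompacts K)

instance : IsFiniteMeasure ((haar K).restrict (integerBall K)) :=
  ⟨by simp [haar_integerBall]⟩

end Topology

/-! ### Completeness of the characters of Λ on the integers. -/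

section Characters

variable {K : Type*} [Field K] [ValuativeRel K] [TopologicalSpace K]
  [IsNonarchimedeanLocalField K] {ϖ : Kˣ} {χ : AddChar K Circle} {Λ : AddSubgroup K}

theorem IsDualLattice.map_eq_of_sub_mem (hΛ : IsDualLattice ϖ χ Λ) {x y : K}
    (h : x - y ∈ integerBall K) : χ x = χ y := by
  have := hΛ.char_integer _ h
  rwa [AddChar.map_sub_eq_div, div_eq_one] at this

/-- Distinct integers are separated by a character `x ↦ χ (λ x)` with `λ ∈ Λ`. -/
theorem IsDualLattice.exists_map_mul_ne_one (hΛ : IsDualLattice ϖ χ Λ) {x : K} (hx : x ≠ 0)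
    (hx1 : x ∈ integerBall K) : ∃ y ∈ Λ, χ (y * x) ≠ 1 := by
  -- Rounding `x⁻¹ * ϖ⁻¹` to Λ makes an integral error, which stays integral after multiplication by
  -- `x`; hence χ(yx) = χ(ϖ⁻¹).
  obtain ⟨y, hy, h⟩ := hΛ.exists_sub_mem (x⁻¹ * (ϖ : K)⁻¹)
  refine ⟨y, hy, ?_⟩
  rw [← hΛ.map_eq_of_sub_mem (x := (ϖ : K)⁻¹)]
  · exact hΛ.char_inv
  · have := mul_mem_integerBall h hx1
    convert this using 1
    field_simp

/-- A character `x ↦ χ (ξ x)` is trivial on the integers only if `ξ` is an integer. -/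
theorem IsDualLattice.exists_integer_map_mul_ne_one (hΛ : IsDualLattice ϖ χ Λ) {x : K}
    (hx : x ∉ integerBall K) : ∃ y ∈ integerBall K, χ (x * y) ≠ 1 := by
  have hx1 : 1 < valuation K x := not_le.1 hx
  have hx0 : x ≠ 0 := by rintro rfl; simp at hx1
  refine ⟨x⁻¹ * (ϖ : K)⁻¹, hΛ.uniformizer.inv_mul_inv_le hx1, ?_⟩
  rw [mul_inv_cancel_left₀ hx0]
  exact hΛ.char_inv

/-- The character `x ↦ χ (λ x)` as a continuous function on the ring of integers. -/
def charOnBall (hχ : Continuous χ) (y : K) : C(integerBall K, ℂ) where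
  toFun x := (χ (y * x) : ℂ)
  continuous_toFun := by fun_prop

/-- The star subalgebra generated by the characters `x ↦ χ (λ x)`, `λ ∈ Λ`. -/
def charAlgebra (hχ : Continuous χ) (Λ : AddSubgroup K) : StarSubalgebra ℂ C(integerBall K, ℂ) where
  toSubalgebra := Algebra.adjoin ℂ (charOnBall hχ '' Λ)
  star_mem' := by
    change Algebra.adjoin ℂ (charOnBall hχ '' Λ) ≤ star (Algebra.adjoin ℂ (charOnBall hχ '' Λ))
    refine Algebra.adjoin_le ?_
    rintro - ⟨y, hy, rfl⟩
    refine Algebra.subset_adjoin ⟨-y, Λ.neg_mem hy, ?_⟩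
    ext x
    simp [charOnBall, AddChar.map_neg_eq_inv, ← Circle.coe_inv_eq_conj]

/-- Λ is a group, so its characters are closed under products and the algebra they generate is their
linear span. Stone–Weierstrass thus becomes a statement about spans. -/
theorem charAlgebra_toSubmodule (hχ : Continuous χ) (Λ : AddSubgroup K) :
    Subalgebra.toSubmodule (charAlgebra hχ Λ).toSubalgebra
      = Submodule.span ℂ (charOnBall hχ '' Λ) := by
  refine Algebra.adjoin_eq_span_of_subset ℂ (Set.Subset.trans (fun f hf => ?_) Submodule.subset_span)
  refine Submonoid.closure_induction (fun _ => id) ⟨0, Λ.zero_mem, ?_⟩ ?_ hf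
  · ext x; simp [charOnBall]
  · rintro _ _ _ _ ⟨y, hy, rfl⟩ ⟨z, hz, rfl⟩
    refine ⟨y + z, Λ.add_mem hy hz, ?_⟩
    ext x
    simp [charOnBall, add_mul, AddChar.map_add_eq_mul]

/-- The characters `x ↦ χ (λ x)`, `λ ∈ Λ`, span a dense subspace of `C(𝔇, ℂ)`. -/
theorem IsDualLattice.span_charOnBall_topologicalClosure (hΛ : IsDualLattice ϖ χ Λ) :
    (Submodule.span ℂ (charOnBall hΛ.continuous '' (Λ : Set K))).topologicalClosure = ⊤ := by
  have : CompactSpace (integerBall K) := isCompact_iff_compactSpace.1 isCompact_integerBall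
  rw [← charAlgebra_toSubmodule]
  have h := ContinuousMap.starSubalgebra_topologicalClosure_eq_top_of_separatesPoints
    (charAlgebra hΛ.continuous Λ) ?_
  · exact congrArg (fun A => Subalgebra.toSubmodule (StarSubalgebra.toSubalgebra A)) h
  · intro x y hxy
    have hne : (x : K) - y ≠ 0 := sub_ne_zero.2 fun h => hxy (Subtype.ext h)
    have hmem : (x : K) - y ∈ integerBall K := by
      rw [sub_eq_add_neg]
      exact add_mem_integerBall x.2 (neg_mem_integerBall.2 y.2)
    obtain ⟨z, hz, h⟩ := hΛ.exists_map_mul_ne_one hne hmem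
    refine ⟨_, ⟨charOnBall hΛ.continuous z, Algebra.subset_adjoin ⟨z, hz, rfl⟩, rfl⟩, fun he => h ?_⟩
    have : χ (z * x) = χ (z * y) := Circle.coe_injective (by simpa [charOnBall] using he)
    rw [mul_sub, AddChar.map_sub_eq_div, this, div_self']

variable [MeasurableSpace K] [BorelSpace K]

theorem enorm_mul_circle (z : ℂ) (c : Circle) : ‖z * (c : ℂ)‖ₑ = ‖z‖ₑ := by
  rw [enorm_mul, ← ofReal_norm_eq_enorm (c : ℂ), Circle.norm_coe, ENNReal.ofReal_one, mul_one]

theorem integrable_mul_circle {μ : Measure K} {g : K → ℂ} (hg : Integrable g μ) {θ : K → Circle}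
    (hθ : Continuous θ) :
    Integrable (fun x => g x * (θ x : ℂ)) μ := by
  refine hg.mul_bdd (c := 1) ?_ ?_
  · exact (continuous_subtype_val.comp hθ).aestronglyMeasurable
  · exact Eventually.of_forall fun x => (Circle.norm_coe _).le

/-- A function on the ring of integers with vanishing Fourier coefficients integrates to zero against
every continuous function. -/
theorem IsDualLattice.setIntegral_mul_eq_zero (hΛ : IsDualLattice ϖ χ Λ) {h : K → ℂ}
    (hh : IntegrableOn h (integerBall K) (haar K))
    (h0 : ∀ y ∈ Λ, ∫ x in integerBall K, h x * (χ (y * x) : ℂ) ∂(haar K) = 0)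
    (φ : C(integerBall K, ℂ)) :
    ∫ x : integerBall K, h x * φ x ∂((haar K).comap Subtype.val) = 0 := by
  have : CompactSpace (integerBall K) := isCompact_iff_compactSpace.1 isCompact_integerBall
  have := hΛ.secondCountableTopology
  set ν := (haar K).comap (Subtype.val : integerBall K → K)
  have hi : Integrable (fun x : integerBall K => h x) ν :=
    (integrableOn_iff_comap_subtypeVal measurableSet_integerBall).1 hh
  have hφi (φ : C(integerBall K, ℂ)) : Integrable (fun x : integerBall K => h x * φ x) ν :=
    hi.mul_bdd (c := ‖φ‖) φ.continuous.aestronglyMeasurable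
      (Eventually.of_forall fun x => φ.norm_coe_le_norm x)
  let I₀ : C(integerBall K, ℂ) →ₗ[ℂ] ℂ :=
    { toFun := fun φ => ∫ x : integerBall K, h x * φ x ∂ν
      map_add' := fun φ ψ => by
        simp only [ContinuousMap.add_apply, mul_add]
        exact integral_add (hφi φ) (hφi ψ)
      map_smul' := fun c φ => by
        simp only [ContinuousMap.smul_apply, smul_eq_mul, mul_left_comm, RingHom.id_apply]
        exact integral_const_mul c _ }
  -- Integration against `h` is bounded by the L¹ norm of `h`, so its kernel is closed and contains
  -- the closed span of the characters.
  let I : C(integerBall K, ℂ) →L[ℂ] ℂ := I₀.mkContinuous (∫ x, ‖h x‖ ∂ν) fun φ => by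
    change ‖∫ x : integerBall K, h x * φ x ∂ν‖ ≤ _
    rw [← integral_mul_const]
    refine norm_integral_le_of_norm_le (hi.norm.mul_const _) (Eventually.of_forall fun x => ?_)
    rw [norm_mul]
    gcongr
    exact φ.norm_coe_le_norm x
  have hker : Submodule.span ℂ (charOnBall hΛ.continuous '' (Λ : Set K)) ≤ I.ker := by
    rw [Submodule.span_le]
    rintro _ ⟨y, hy, rfl⟩
    change ∫ x : integerBall K, h x * (χ (y * x) : ℂ) ∂ν = 0
    rw [← h0 y hy]
    exact integral_subtype_comap measurableSet_integerBall fun x => h x * (χ (y * x) : ℂ)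
  have := Submodule.topologicalClosure_minimal _ hker I.isClosed_ker
  rw [hΛ.span_charOnBall_topologicalClosure] at this
  exact this (Submodule.mem_top (x := φ))

/-- An integrable function on the ring of integers is determined by its Fourier coefficients. -/
theorem IsDualLattice.ae_eq_zero_of_setIntegral_eq_zero (hΛ : IsDualLattice ϖ χ Λ) {h : K → ℂ}
    (hh : IntegrableOn h (integerBall K) (haar K))
    (h0 : ∀ y ∈ Λ, ∫ x in integerBall K, h x * (χ (y * x) : ℂ) ∂(haar K) = 0) :
    h =ᵐ[(haar K).restrict (integerBall K)] 0 := by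
  have := hΛ.secondCountableTopology
  refine Integrable.ae_eq_zero_of_forall_setIntegral_eq_zero hh fun s hs _ => ?_
  have huniv : ∫ x in integerBall K, h x ∂(haar K) = 0 := by
    simpa using h0 0 Λ.zero_mem
  -- Clopen sets form a π-system generating the Borel sets, and their indicators are continuous;
  -- `huniv` handles complements.
  have hgen : ‹MeasurableSpace K› = MeasurableSpace.generateFrom {s : Set K | IsClopen s} := by
    rw [← hΛ.isTopologicalBasis_isClopen.borel_eq_generateFrom]
    exact BorelSpace.measurable_eq
  induction s, hs using MeasurableSpace.induction_on_inter hgen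
    (fun s hs t ht _ => IsClopen.inter hs ht) with
  | empty => simp
  | basic s hs =>
    have hs' : IsClopen s := hs
    have hc : IsClopen ((↑) ⁻¹' s : Set (integerBall K)) := hs'.preimage continuous_subtype_val
    have := hΛ.setIntegral_mul_eq_zero hh h0 (LocallyConstant.charFn ℂ hc).toContinuousMap
    rw [← this, Measure.restrict_restrict hs'.isOpen.measurableSet, Set.inter_comm,
      ← setIntegral_indicator hs'.isOpen.measurableSet,
      ← integral_subtype_comap measurableSet_integerBall]
    refine integral_congr_ae (Eventually.of_forall fun x => ?_)
    by_cases hx : (x : K) ∈ s <;> simp [LocallyConstant.charFn, hx]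
  | compl s hs ih =>
    have := integral_add_compl (μ := (haar K).restrict (integerBall K)) hs hh
    rw [ih (measure_lt_top _ _), zero_add, huniv] at this
    exact this
  | iUnion f hd hf ih =>
    rw [integral_iUnion hf hd hh.integrableOn]
    simp [ih _ (measure_lt_top _ _)]

end Characters

/-! ### Sums over cosets of Λ. -/

section Periodization

variable {K : Type*} [Field K] [ValuativeRel K] [TopologicalSpace K]
  [IsNonarchimedeanLocalField K] {ϖ : Kˣ} {χ : AddChar K Circle} {Λ : AddSubgroup K}
  [MeasurableSpace K] [BorelSpace K]

theorem IsDualLattice.existsUnique_vadd_mem (hΛ : IsDualLattice ϖ χ Λ) (x : K) :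
    ∃! y : Λ, y +ᵥ x ∈ integerBall K := by
  obtain ⟨y, hy, h⟩ := hΛ.exists_sub_mem x
  refine ⟨⟨-y, Λ.neg_mem hy⟩, ?_, fun z hz => ?_⟩
  · change -y + x ∈ integerBall K
    rwa [neg_add_eq_sub]
  · have hz' : (z : K) + x ∈ integerBall K := hz
    have h1 := add_mem_integerBall hz' (neg_mem_integerBall.2 h)
    have h2 := hΛ.eq_zero (z + y) (Λ.add_mem z.2 hy) (by rw [← mem_integerBall]; convert h1 using 1; ring)
    exact Subtype.ext (eq_neg_of_add_eq_zero_left h2)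

theorem IsDualLattice.isAddFundamentalDomain (hΛ : IsDualLattice ϖ χ Λ) :
    IsAddFundamentalDomain Λ (integerBall K) (haar K) :=
  .mk' measurableSet_integerBall.nullMeasurableSet hΛ.existsUnique_vadd_mem

theorem IsDualLattice.map_mul_vadd (hΛ : IsDualLattice ϖ χ Λ) {y : K} (hy : y ∈ Λ) (z : Λ)
    (x : K) : χ (y * (z +ᵥ x)) = χ (y * x) := by
  change χ (y * (z + x)) = _
  rw [mul_add, AddChar.map_add_eq_mul, hΛ.char_mul y hy z z.2, one_mul]

theorem IsDualLattice.tsum_lintegral_ne_top (hΛ : IsDualLattice ϖ χ Λ) {g : K → ℂ}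
    (hg : Integrable g (haar K)) :
    ∑' z : Λ, ∫⁻ x : K in integerBall K, ‖g (z +ᵥ x)‖ₑ ∂(haar K) ≠ ∞ := by
  have : Countable Λ := hΛ.countable.to_subtype
  rw [← hΛ.isAddFundamentalDomain.lintegral_eq_tsum'' fun x => ‖g x‖ₑ]
  exact hg.2.ne

theorem integrable_comp_vadd {g : K → ℂ} (hg : Integrable g (haar K)) (z : Λ) :
    Integrable (fun x : K => g (z +ᵥ x)) (haar K) :=
  hg.comp_add_left (z : K)

/-- The L¹(𝔇) norms of the translates add up to the L¹ norm of `g`, so the series converges in L¹,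
and its sum agrees almost everywhere with the pointwise one. -/
theorem IsDualLattice.integrableOn_tsum_vadd (hΛ : IsDualLattice ϖ χ Λ) {g : K → ℂ}
    (hg : Integrable g (haar K)) :
    IntegrableOn (fun x : K => ∑' z : Λ, g (z +ᵥ x)) (integerBall K) (haar K) := by
  have : Countable Λ := hΛ.countable.to_subtype
  let f : Λ → Lp ℂ 1 ((haar K).restrict (integerBall K)) :=
    fun z => ((integrable_comp_vadd hg z).restrict (s := integerBall K)).toL1 _
  have hf : ∑' z, ‖f z‖ₑ ≠ ∞ := by
    convert hΛ.tsum_lintegral_ne_top hg using 3 with z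
    rw [Lp.enorm_def, eLpNorm_congr_ae (Integrable.coeFn_toL1 _), eLpNorm_one_eq_lintegral_enorm]
  have hall : ∀ᵐ x ∂(haar K).restrict (integerBall K), ∀ z, f z x = g (z +ᵥ x) :=
    ae_all_iff.2 fun z => Integrable.coeFn_toL1 _
  refine (L1.integrable_coeFn (∑' z, f z)).congr ?_
  filter_upwards [Lp.hasSum_coeFn_tsum hf, hall] with x hx hz
  simp_rw [hz] at hx
  exact hx.tsum_eq.symm

/-- Unfolding over the tiling by 𝔇; periodicity of the character under Λ lets it leave the sum. -/
theorem IsDualLattice.setIntegral_tsum_vadd_mul (hΛ : IsDualLattice ϖ χ Λ) {g : K → ℂ}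
    (hg : Integrable g (haar K)) {y : K} (hy : y ∈ Λ) :
    ∫ x in integerBall K, (∑' z : Λ, g (z +ᵥ x)) * (χ (y * x) : ℂ) ∂(haar K)
      = ∫ x, g x * (χ (y * x) : ℂ) ∂(haar K) := by
  have := hΛ.secondCountableTopology
  have : Countable Λ := hΛ.countable.to_subtype
  have hθ : Continuous fun x => χ (y * x) := hΛ.continuous.comp (continuous_const_mul y)
  rw [hΛ.isAddFundamentalDomain.integral_eq_tsum'' _ (integrable_mul_circle hg hθ)]
  simp_rw [hΛ.map_mul_vadd hy, ← tsum_mul_right]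
  refine integral_tsum (fun z => ?_) ?_
  · exact (integrable_mul_circle (integrable_comp_vadd hg z) hθ).restrict.aestronglyMeasurable
  · simpa only [enorm_mul_circle] using hΛ.tsum_lintegral_ne_top hg

theorem ae_comp_add {P : K → Prop} (w : K) (h : ∀ᵐ x ∂(haar K), P x) :
    ∀ᵐ x ∂(haar K), P (w + x) :=
  (measurePreserving_add_left (haar K) w).quasiMeasurePreserving.ae h

/-- A `Λ`-invariant property that holds almost everywhere on the integers holds almost
everywhere. -/
theorem IsDualLattice.ae_of_ae_restrict (hΛ : IsDualLattice ϖ χ Λ) {T : K → Prop}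
    (hT : ∀ (w : Λ) (x : K), T (w +ᵥ x) → T x)
    (h : ∀ᵐ x ∂(haar K).restrict (integerBall K), T x) : ∀ᵐ x ∂(haar K), T x := by
  have : Countable Λ := hΛ.countable.to_subtype
  rw [ae_restrict_iff' measurableSet_integerBall] at h
  have h' : ∀ᵐ x ∂(haar K), ∀ w : Λ, (w : K) + x ∈ integerBall K → T ((w : K) + x) :=
    ae_all_iff.2 fun w => ae_comp_add (P := fun x => x ∈ integerBall K → T x) w h
  filter_upwards [h'] with x hx
  obtain ⟨w, hw, -⟩ := hΛ.existsUnique_vadd_mem x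
  exact hT w x (hx w hw)

/-- If all the integrals of `g` against the characters of `Λ` vanish, then so do the sums of `g`
over the cosets of `Λ`. -/
theorem IsDualLattice.ae_tsum_eq_zero (hΛ : IsDualLattice ϖ χ Λ) {g : K → ℂ}
    (hg : Integrable g (haar K))
    (h0 : ∀ y ∈ Λ, ∫ x, g x * (χ (y * x) : ℂ) ∂(haar K) = 0) :
    ∀ᵐ x : K ∂(haar K), ∑' z : Λ, g (z +ᵥ x) = 0 := by
  have hz := hΛ.ae_eq_zero_of_setIntegral_eq_zero (hΛ.integrableOn_tsum_vadd hg) fun y hy =>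
    (hΛ.setIntegral_tsum_vadd_mul hg hy).trans (h0 y hy)
  refine hΛ.ae_of_ae_restrict (fun w x h => ?_) hz
  rw [← h, ← (Equiv.addRight w).tsum_eq fun z : Λ => g (z +ᵥ x)]
  refine tsum_congr fun z => congrArg g ?_
  exact add_vadd z w x

end Periodization

end LocalFieldWavelet

end

noncomputable section

namespace LocalFieldWavelet

variable {K : Type*} [Field K] [ValuativeRel K] [TopologicalSpace K]
  [IsNonarchimedeanLocalField K] [MeasurableSpace K] [BorelSpace K]
  {ϖ : Kˣ} {χ : AddChar K Circle} {Λ : AddSubgroup K}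

/-! ### Affine substitutions on L²(K). -/

section Affine

open scoped Pointwise in
/-- The factor by which dilation by `a` scales the Haar measure. -/
def modulus (a : Kˣ) : NNReal := distribHaarChar K a

theorem modulus_pos (a : Kˣ) : 0 < modulus a := distribHaarChar_pos

theorem modulus_pow (a : Kˣ) (n : ℕ) : modulus (a ^ n) = modulus a ^ n :=
  map_pow (distribHaarChar K) a n

theorem modulus_inv (a : Kˣ) : modulus a⁻¹ = (modulus a)⁻¹ :=
  map_inv (distribHaarChar K) a

open scoped Pointwise in
theorem haar_preimage_mul (a : Kˣ) (s : Set K) :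
    haar K ((fun x => (a : K) * x) ⁻¹' s) = ((modulus a)⁻¹ : NNReal) * haar K s := by
  rw [← modulus_inv, modulus, distribHaarChar_mul]
  congr 1
  ext x
  rw [Set.mem_inv_smul_set_iff]
  rfl

theorem map_mul_haar (a : Kˣ) :
    Measure.map (fun x => (a : K) * x) (haar K) = (modulus a)⁻¹ • haar K := by
  ext s hs
  rw [Measure.map_apply (by fun_prop) hs, haar_preimage_mul]
  rfl

/-- The factor by which the substitution `x ↦ a x` changes integrals. -/
def dilationFactor (a : Kˣ) : ℂ := (((modulus a : ℝ)⁻¹ : ℝ) : ℂ)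

theorem dilationFactor_ne_zero (a : Kˣ) : dilationFactor a ≠ 0 := by
  have := (modulus_pos a).ne'
  simpa [dilationFactor] using this

theorem map_affine_haar (a : Kˣ) (b : K) :
    Measure.map (fun x => (a : K) * x - b) (haar K) = (modulus a)⁻¹ • haar K := by
  have : (fun x => (a : K) * x - b) = (fun x => x - b) ∘ fun x => (a : K) * x := rfl
  rw [this, ← Measure.map_map (by fun_prop) (by fun_prop), map_mul_haar, Measure.map_smul,
    (measurePreserving_sub_right (haar K) b).map_eq]

theorem quasiMeasurePreserving_affine (a : Kˣ) (b : K) :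
    Measure.QuasiMeasurePreserving (fun x => (a : K) * x - b) (haar K) (haar K) :=
  ⟨by fun_prop, by rw [map_affine_haar]; exact Measure.smul_absolutelyContinuous⟩

theorem measurableEmbedding_affine (a : Kˣ) (b : K) :
    MeasurableEmbedding fun x : K => (a : K) * x - b :=
  ((Homeomorph.mulLeft₀ (a : K) a.ne_zero).trans (Homeomorph.subRight b)).measurableEmbedding

theorem integral_comp_affine (a : Kˣ) (b : K) (f : K → ℂ) :
    ∫ x, f ((a : K) * x - b) ∂(haar K) = dilationFactor a * ∫ x, f x ∂(haar K) := by
  rw [← (measurableEmbedding_affine a b).integral_map, map_affine_haar,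
    integral_smul_nnreal_measure, NNReal.smul_def, Complex.real_smul, dilationFactor,
    NNReal.coe_inv]

theorem integrable_comp_affine (a : Kˣ) (b : K) {f : K → ℂ} (hf : Integrable f (haar K)) :
    Integrable (fun x => f ((a : K) * x - b)) (haar K) := by
  have := hf.smul_measure_nnreal (c := (modulus a)⁻¹)
  rw [← map_affine_haar a b] at this
  exact (measurableEmbedding_affine a b).integrable_map_iff.1 this

theorem coeFn_affine (a : Kˣ) (b : K) (f : L2 K) :
    affine a b f =ᵐ[haar K] fun x => f ((a : K) * x - b) :=
  MemLp.coeFn_toLp _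

theorem affine_add (a : Kˣ) (b : K) (f g : L2 K) :
    affine a b (f + g) = affine a b f + affine a b g := by
  refine Lp.ext ?_
  filter_upwards [coeFn_affine a b (f + g), coeFn_affine a b f, coeFn_affine a b g,
    Lp.coeFn_add (affine a b f) (affine a b g),
    (quasiMeasurePreserving_affine a b).ae (Lp.coeFn_add f g)] with x h1 h2 h3 h4 h5
  rw [h1, h4, h5, Pi.add_apply, Pi.add_apply, h2, h3]

theorem affine_smul (a : Kˣ) (b : K) (c : ℂ) (f : L2 K) :
    affine a b (c • f) = c • affine a b f := by
  refine Lp.ext ?_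
  filter_upwards [coeFn_affine a b (c • f), coeFn_affine a b f,
    Lp.coeFn_smul c (affine a b f),
    (quasiMeasurePreserving_affine a b).ae (Lp.coeFn_smul c f)] with x h1 h2 h3 h4
  rw [h1, h3, h4, Pi.smul_apply, Pi.smul_apply, h2]

theorem inner_affine (a : Kˣ) (b : K) (f g : L2 K) :
    inner ℂ (affine a b f) (affine a b g) = dilationFactor a * inner ℂ f g := by
  rw [L2.inner_def, L2.inner_def, ← integral_comp_affine a b]
  refine integral_congr_ae ?_
  filter_upwards [coeFn_affine a b f, coeFn_affine a b g] with x h1 h2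
  rw [h1, h2]

theorem norm_affine (a : Kˣ) (b : K) (f : L2 K) :
    ‖affine a b f‖ = Real.sqrt ((modulus a)⁻¹ : NNReal) * ‖f‖ := by
  rw [← sq_eq_sq₀ (norm_nonneg _) (by positivity), mul_pow, Real.sq_sqrt (by positivity),
    ← @inner_self_eq_norm_sq ℂ, ← @inner_self_eq_norm_sq ℂ, inner_affine]
  simp [dilationFactor]

/-- The operator `f ↦ f(a x - b)` of `L²(K)`. -/
def affineCLM (a : Kˣ) (b : K) : L2 K →L[ℂ] L2 K :=
  LinearMap.mkContinuous
    { toFun := affine a b, map_add' := affine_add a b, map_smul' := affine_smul a b }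
    (Real.sqrt ((modulus a)⁻¹ : NNReal)) fun f => (norm_affine a b f).le

@[simp]
theorem affine_affine (a a' : Kˣ) (b b' : K) (f : L2 K) :
    affine a b (affine a' b' f) = affine (a' * a) (a' * b + b') f := by
  refine Lp.ext ?_
  filter_upwards [coeFn_affine a b (affine a' b' f), coeFn_affine (a' * a) (a' * b + b') f,
    (quasiMeasurePreserving_affine a b).ae (coeFn_affine a' b' f)] with x h1 h2 h3
  rw [h1, h2, h3, Units.val_mul]
  congr 1; ring

theorem affine_one_zero (f : L2 K) : affine 1 0 f = f := by
  refine Lp.ext ?_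
  filter_upwards [coeFn_affine 1 0 f] with x h1
  simp [h1]

end Affine

/-! ### Modulations. -/

section Modulate

theorem coe_char_neg (χ : AddChar K Circle) (x : K) : (χ (-x) : ℂ) = conj (χ x : ℂ) := by
  rw [AddChar.map_neg_eq_inv, Circle.coe_inv_eq_conj]

theorem memLp_modulate (hχ : Continuous χ) (b : K) (f : L2 K) :
    MemLp (fun x => conj (χ (b * x) : ℂ) * f x) 2 (haar K) := by
  refine (memLp_congr_norm ?_ (Lp.aestronglyMeasurable f) ?_).2 (Lp.memLp f)
  · refine Continuous.aestronglyMeasurable ?_ |>.mul (Lp.aestronglyMeasurable f)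
    exact Complex.continuous_conj.comp
      (continuous_subtype_val.comp (hχ.comp (continuous_const_mul b)))
  · refine Eventually.of_forall fun x => ?_
    rw [norm_mul, RCLike.norm_conj, Circle.norm_coe, one_mul]

/-- The operator of multiplication by `x ↦ conj χ(b x)` on `L²(K)`. -/
def modulate (hχ : Continuous χ) (b : K) : L2 K →L[ℂ] L2 K :=
  LinearMap.mkContinuous
    { toFun := fun f => ((memLp_modulate hχ b f).toLp : L2 K)
      map_add' := fun f g => by
        refine Lp.ext ?_
        filter_upwards [(memLp_modulate hχ b (f + g)).coeFn_toLp, (memLp_modulate hχ b f).coeFn_toLp,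
          (memLp_modulate hχ b g).coeFn_toLp, Lp.coeFn_add f g,
          Lp.coeFn_add ((memLp_modulate hχ b f).toLp : L2 K) ((memLp_modulate hχ b g).toLp : L2 K)]
          with x h1 h2 h3 h4 h5
        rw [h1, h5, Pi.add_apply, h2, h3, h4, Pi.add_apply, mul_add]
      map_smul' := fun c f => by
        refine Lp.ext ?_
        filter_upwards [(memLp_modulate hχ b (c • f)).coeFn_toLp, (memLp_modulate hχ b f).coeFn_toLp,
          Lp.coeFn_smul c f, Lp.coeFn_smul c ((memLp_modulate hχ b f).toLp : L2 K)] with x h1 h2 h3 h4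
        rw [h1, h3, RingHom.id_apply, h4, Pi.smul_apply, Pi.smul_apply, h2, smul_eq_mul,
          smul_eq_mul, mul_left_comm] }
    1 fun f => by
      rw [one_mul]
      refine Lp.norm_le_norm_of_ae_le ?_
      filter_upwards [(memLp_modulate hχ b f).coeFn_toLp] with x h
      change ‖((memLp_modulate hχ b f).toLp : L2 K) x‖ ≤ _
      rw [h, norm_mul, RCLike.norm_conj, Circle.norm_coe, one_mul]

theorem coeFn_modulate (hχ : Continuous χ) (b : K) (f : L2 K) :
    modulate hχ b f =ᵐ[haar K] fun x => conj (χ (b * x) : ℂ) * f x :=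
  (memLp_modulate hχ b f).coeFn_toLp

end Modulate

/-! ### An orthonormal basis that the Fourier transform maps to another one. -/

section Gabor

theorem indicator_one_congr {α : Type*} {s : Set α} {x y : α} (h : x ∈ s ↔ y ∈ s) :
    s.indicator (1 : α → ℂ) x = s.indicator 1 y := by
  by_cases hx : x ∈ s
  · simp [hx, h.1 hx]
  · rw [Set.indicator_of_notMem hx, Set.indicator_of_notMem fun hy => hx (h.2 hy)]

/-- The function `x ↦ 1_𝔇(x - a) χ(b x)`. -/
def gaborFun (χ : AddChar K Circle) (a b x : K) : ℂ :=
  (integerBall K).indicator 1 (x - a) * (χ (b * x) : ℂ)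

theorem integrable_indicator_sub (a : K) :
    Integrable (fun x => (integerBall K).indicator (1 : K → ℂ) (x - a)) (haar K) := by
  refine Integrable.comp_sub_right (f := (integerBall K).indicator (1 : K → ℂ)) ?_ a
  rw [integrable_indicator_iff measurableSet_integerBall]
  exact integrable_const (1 : ℂ)

theorem integrable_gaborFun (hχ : Continuous χ) (a b : K) :
    Integrable (gaborFun χ a b) (haar K) :=
  integrable_mul_circle (integrable_indicator_sub a) (hχ.comp (continuous_const_mul b))

theorem norm_gaborFun_le (a b x : K) : ‖gaborFun χ a b x‖ ≤ 1 := by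
  rw [gaborFun, norm_mul, Circle.norm_coe, mul_one]
  by_cases h : x - a ∈ integerBall K <;> simp [h]

theorem memLp_gaborFun (hχ : Continuous χ) (a b : K) :
    MemLp (gaborFun χ a b) 2 (haar K) := by
  have h := integrable_gaborFun hχ a b
  refine (memLp_two_iff_integrable_sq_norm h.aestronglyMeasurable).2 ?_
  refine h.norm.mono' (h.aestronglyMeasurable.norm.pow 2) (Eventually.of_forall fun x => ?_)
  rw [norm_pow, norm_norm, sq]
  exact mul_le_of_le_one_left (norm_nonneg _) (norm_gaborFun_le a b x)

/-- The Gabor atom `x ↦ 1_𝔇(x - a) χ(b x)` as an element of `L²(K)`. -/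
def gabor (hχ : Continuous χ) (a b : K) : L2 K := (memLp_gaborFun hχ a b).toLp

theorem coeFn_gabor (hχ : Continuous χ) (a b : K) :
    gabor hχ a b =ᵐ[haar K] gaborFun χ a b :=
  (memLp_gaborFun hχ a b).coeFn_toLp

/-- The Fourier transform of the indicator function of the ring of integers is itself. -/
theorem IsDualLattice.integral_indicator_mul_char (hΛ : IsDualLattice ϖ χ Λ) (y : K) :
    ∫ x, (integerBall K).indicator 1 x * (χ (y * x) : ℂ) ∂(haar K)
      = (integerBall K).indicator 1 y := by
  by_cases hy : y ∈ integerBall K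
  · have h (x : K) : (integerBall K).indicator 1 x * (χ (y * x) : ℂ)
        = (integerBall K).indicator 1 x := by
      by_cases hx : x ∈ integerBall K
      · rw [hΛ.char_integer _ (mul_mem_integerBall hy hx)]; simp
      · simp [hx]
    simp_rw [h]
    rw [integral_indicator measurableSet_integerBall]
    simp [Measure.real, haar_integerBall, hy]
  · obtain ⟨z, hz, hne⟩ := hΛ.exists_integer_map_mul_ne_one hy
    -- Translating by `z` leaves the integral unchanged but multiplies it by χ(yz) ≠ 1, so it
    -- vanishes.
    have h := integral_add_left_eq_self (μ := haar K)
      (fun x => (integerBall K).indicator 1 x * (χ (y * x) : ℂ)) z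
    have h' (x : K) : (integerBall K).indicator 1 (z + x) * (χ (y * (z + x)) : ℂ)
        = (χ (y * z) : ℂ) * ((integerBall K).indicator 1 x * (χ (y * x) : ℂ)) := by
      rw [mul_add, AddChar.map_add_eq_mul, Circle.coe_mul]
      have : (integerBall K).indicator (1 : K → ℂ) (z + x) = (integerBall K).indicator 1 x := by
        exact indicator_one_congr (add_mem_integerBall_iff hz)
      rw [this]; ring
    simp_rw [h'] at h
    rw [integral_const_mul] at h
    have hne' : (χ (y * z) : ℂ) - 1 ≠ 0 := by
      rw [sub_ne_zero, ← Circle.coe_one]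
      exact fun h => hne (Circle.coe_injective h)
    rw [Set.indicator_of_notMem hy]
    refine (mul_eq_zero.1 ?_).resolve_left hne'
    rw [sub_mul, one_mul, h, sub_self]

/-- The substitution `x - a` reduces this to the self-dual indicator of 𝔇. The phase χ(ba) that
would appear is 1 on Λ, so atoms go exactly to atoms. -/
theorem IsDualLattice.integral_gaborFun_mul (hΛ : IsDualLattice ϖ χ Λ) {a b : K} (ha : a ∈ Λ)
    (hb : b ∈ Λ) (ξ : K) :
    ∫ x, gaborFun χ a b x * conj (χ (ξ * x) : ℂ) ∂(haar K) = gaborFun χ b (-a) ξ := by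
  have h (x : K) : gaborFun χ a b x * conj (χ (ξ * x) : ℂ)
      = (χ (-a * ξ) : ℂ) * ((integerBall K).indicator 1 (x - a) * (χ ((b - ξ) * (x - a)) : ℂ)) := by
    have e : (b - ξ) * (x - a) = b * x + -(ξ * x) + a * ξ + -(b * a) := by ring
    have e' : -a * ξ = -(a * ξ) := by ring
    have h1 := hΛ.char_mul b hb a ha
    rw [e, e', ← coe_char_neg, gaborFun, AddChar.map_add_eq_mul, AddChar.map_add_eq_mul,
      AddChar.map_add_eq_mul, AddChar.map_neg_eq_inv χ (b * a), h1,
      AddChar.map_neg_eq_inv χ (a * ξ)]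
    simp only [inv_one, mul_one, Circle.coe_mul, Circle.coe_inv]
    have := Circle.coe_ne_zero (χ (a * ξ))
    field_simp
  simp_rw [h]
  rw [integral_const_mul, integral_sub_right_eq_self
    (fun x => (integerBall K).indicator 1 x * (χ ((b - ξ) * x) : ℂ)) a,
    hΛ.integral_indicator_mul_char, gaborFun, mul_comm]
  congr 1
  rw [← neg_sub ξ b]
  exact indicator_one_congr neg_mem_integerBall

theorem IsDualLattice.sub_mem_integerBall_iff (hΛ : IsDualLattice ϖ χ Λ) {a b : K} (ha : a ∈ Λ)
    (hb : b ∈ Λ) : a - b ∈ integerBall K ↔ a = b := by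
  refine ⟨fun h => sub_eq_zero.1 (hΛ.eq_zero _ (Λ.sub_mem ha hb) h), ?_⟩
  rintro rfl
  simp [mem_integerBall]

/-- Atoms at different positions have disjoint supports. At equal positions the inner product is a
value of the transform of an atom, which is supported in one coset of 𝔇. -/
theorem IsDualLattice.orthonormal_gabor (hΛ : IsDualLattice ϖ χ Λ) :
    Orthonormal ℂ fun i : Λ × Λ => gabor hΛ.continuous (i.1 : K) i.2 := by
  classical
  rw [orthonormal_iff_ite]
  rintro ⟨⟨a, ha⟩, ⟨b, hb⟩⟩ ⟨⟨c, hc⟩, ⟨d, hd⟩⟩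
  have h1 : inner ℂ (gabor hΛ.continuous a b) (gabor hΛ.continuous c d)
      = ∫ x, gaborFun χ c d x * conj (gaborFun χ a b x) ∂(haar K) := by
    rw [L2.inner_def]
    refine integral_congr_ae ?_
    filter_upwards [coeFn_gabor hΛ.continuous a b, coeFn_gabor hΛ.continuous c d] with x h1 h2
    rw [h1, h2, RCLike.inner_apply]
  change inner ℂ (gabor hΛ.continuous a b) (gabor hΛ.continuous c d) = _
  rw [h1]
  by_cases hac : a = c
  · subst hac
    have h (x : K) : gaborFun χ a d x * conj (gaborFun χ a b x)
        = gaborFun χ a d x * conj (χ (b * x) : ℂ) := by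
      by_cases hx : x - a ∈ integerBall K <;> simp [gaborFun, hx]
    simp_rw [h]
    rw [hΛ.integral_gaborFun_mul ha hd, gaborFun]
    by_cases hbd : b = d
    · subst hbd
      have : χ (-a * b) = 1 := hΛ.char_mul _ (Λ.neg_mem ha) _ hb
      rw [this]
      simp [mem_integerBall]
    · have : b - d ∉ integerBall K := by rwa [hΛ.sub_mem_integerBall_iff hb hd]
      simp [this, hbd]
  · have h (x : K) : gaborFun χ c d x * conj (gaborFun χ a b x) = 0 := by
      by_cases hx : x - c ∈ integerBall K
      · have hxa : x - a ∉ integerBall K := fun hxa => hac <| by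
          rw [← hΛ.sub_mem_integerBall_iff ha hc]
          have := add_mem_integerBall hx (neg_mem_integerBall.2 hxa)
          convert this using 1; ring
        simp [gaborFun, hxa]
      · simp [gaborFun, hx]
    simp [h, hac]

/-- Orthogonality to all atoms located on a + 𝔇 kills the coset sums of `f` cut off to that ball; a
coset of Λ meets the ball only once, so such a sum is a single value of `f`. -/
theorem IsDualLattice.span_gabor_orthogonal (hΛ : IsDualLattice ϖ χ Λ) :
    (Submodule.span ℂ (Set.range fun i : Λ × Λ => gabor hΛ.continuous (i.1 : K) i.2))ᗮ = ⊥ := by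
  have : Countable Λ := hΛ.countable.to_subtype
  rw [Submodule.eq_bot_iff]
  intro f hf
  have hort (a b : K) (ha : a ∈ Λ) (hb : b ∈ Λ) :
      ∫ x, f x * conj (gaborFun χ a b x) ∂(haar K) = 0 := by
    have h := (Submodule.mem_orthogonal _ _).1 hf _
      (Submodule.subset_span ⟨(⟨a, ha⟩, ⟨b, hb⟩), rfl⟩)
    rw [← h, L2.inner_def]
    refine integral_congr_ae ?_
    filter_upwards [coeFn_gabor hΛ.continuous a b] with x h1
    rw [RCLike.inner_apply]
    exact congrArg (fun z => f x * conj z) h1.symm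
  obtain ⟨g, hg⟩ : ∃ g : K → K → ℂ, ∀ a x,
    g a x = f x * (integerBall K).indicator 1 (x - a) := ⟨_, fun _ _ => rfl⟩
  have hae : ∀ᵐ x : K ∂(haar K), ∀ a : Λ, ∑' z : Λ, g a (z +ᵥ x) = 0 := by
    refine ae_all_iff.2 fun a => ?_
    have hint : Integrable (g a) (haar K) := by
      have h1 := (memLp_gaborFun hΛ.continuous (a : K) 0).integrable_mul (Lp.memLp f)
      refine h1.congr (Eventually.of_forall fun x => ?_)
      simp [gaborFun, mul_comm, hg]
    refine hΛ.ae_tsum_eq_zero hint fun y hy => ?_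
    rw [← hort a (-y) a.2 (Λ.neg_mem hy)]
    refine integral_congr_ae (Eventually.of_forall fun x => ?_)
    simp only [hg]
    rw [gaborFun, RingHom.map_mul, ← coe_char_neg, neg_mul, neg_neg, mul_assoc]
    congr 2
    by_cases hx : x - a ∈ integerBall K <;> simp [hx]
  refine Lp.ext ?_
  filter_upwards [hae, Lp.coeFn_zero ℂ 2 (haar K)] with x hx h0
  rw [h0]
  obtain ⟨a, ha, hxa⟩ := hΛ.exists_sub_mem x
  have hxa' : x - a ∈ integerBall K := hxa
  have h := hx ⟨a, ha⟩
  rw [tsum_eq_single 0] at h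
  · rw [zero_vadd, hg] at h
    simpa [hxa'] using h
  · intro z hz
    have : (z : K) + x - a ∉ integerBall K := fun hmem => hz <| by
      have h2 := add_mem_integerBall hmem (neg_mem_integerBall.2 hxa')
      have h3 : (z : K) + x - a + -(x - a) = z := by ring
      rw [h3] at h2
      exact Subtype.ext (hΛ.eq_zero z z.2 h2)
    have e : z +ᵥ x = (z : K) + x := rfl
    rw [e, hg]
    simp [this]

/-- The Gabor atoms with parameters in `Λ` form an orthonormal basis of `L²(K)`. -/
def IsDualLattice.gaborBasis (hΛ : IsDualLattice ϖ χ Λ) : HilbertBasis (Λ × Λ) ℂ (L2 K) :=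
  HilbertBasis.mkOfOrthogonalEqBot hΛ.orthonormal_gabor hΛ.span_gabor_orthogonal

theorem IsDualLattice.gaborBasis_apply (hΛ : IsDualLattice ϖ χ Λ) (i : Λ × Λ) :
    hΛ.gaborBasis i = gabor hΛ.continuous (i.1 : K) i.2 := by
  rw [gaborBasis, HilbertBasis.coe_mkOfOrthogonalEqBot]

/-- The Fourier transforms of the Gabor atoms with parameters in `Λ`. -/
def IsDualLattice.gaborBasis' (hΛ : IsDualLattice ϖ χ Λ) : HilbertBasis (Λ × Λ) ℂ (L2 K) :=
  HilbertBasis.mkOfOrthogonalEqBot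
    (v := fun i : Λ × Λ => gabor hΛ.continuous (i.2 : K) (-i.1))
    (hΛ.orthonormal_gabor.comp (fun i : Λ × Λ => (i.2, -i.1)) fun i j h => by
      simpa [Prod.ext_iff, and_comm] using h) (by
    rw [← hΛ.span_gabor_orthogonal]
    congr 2
    have hs : Function.Surjective fun i : Λ × Λ => (i.2, -i.1) := fun i => ⟨(-i.2, i.1), by simp⟩
    exact hs.range_comp fun i : Λ × Λ => gabor hΛ.continuous (i.1 : K) i.2)

theorem IsDualLattice.gaborBasis'_apply (hΛ : IsDualLattice ϖ χ Λ) (i : Λ × Λ) :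
    hΛ.gaborBasis' i = gabor hΛ.continuous (i.2 : K) (-i.1) := by
  rw [gaborBasis', HilbertBasis.coe_mkOfOrthogonalEqBot]

end Gabor

/-! ### Plancherel's theorem and the transform of affine substitutions. -/

section Fourier

/-- The Fourier transform as a unitary operator on `L²(K)`. -/
def IsDualLattice.fourier (hΛ : IsDualLattice ϖ χ Λ) : L2 K ≃ₗᵢ[ℂ] L2 K :=
  hΛ.gaborBasis.repr.trans hΛ.gaborBasis'.repr.symm

theorem IsDualLattice.fourier_gaborBasis (hΛ : IsDualLattice ϖ χ Λ) (i : Λ × Λ) :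
    hΛ.fourier (hΛ.gaborBasis i) = hΛ.gaborBasis' i := by
  classical
  rw [fourier, LinearIsometryEquiv.trans_apply, HilbertBasis.repr_self,
    HilbertBasis.repr_symm_single]

/-- The operator carries Gabor coefficients unchanged to the transformed basis, so its values can be
tested coefficientwise. -/
theorem IsDualLattice.fourier_eq_iff (hΛ : IsDualLattice ϖ χ Λ) (f g : L2 K) :
    hΛ.fourier f = g ↔ ∀ i, inner ℂ (hΛ.gaborBasis i) f = inner ℂ (hΛ.gaborBasis' i) g := by
  rw [fourier, LinearIsometryEquiv.trans_apply, LinearIsometryEquiv.symm_apply_eq]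
  constructor
  · intro h i
    rw [← HilbertBasis.repr_apply_apply, ← HilbertBasis.repr_apply_apply, h]
  · intro h
    refine lp.ext (funext fun i => ?_)
    rw [HilbertBasis.repr_apply_apply, HilbertBasis.repr_apply_apply, h]

/-- The graph of the Fourier transform on `L¹(K) ∩ L²(K)`. -/
def fourierGraph (χ : AddChar K Circle) : Set (L2 K × L2 K) :=
  {ab : L2 K × L2 K | Integrable ab.1 (haar K) ∧
    ab.2 =ᵐ[haar K] fun ξ => ∫ x, ab.1 x * conj ((χ (ξ * x) : Circle) : ℂ) ∂(haar K)}

theorem IsDualLattice.gaborBasis_mem_fourierGraph (hΛ : IsDualLattice ϖ χ Λ) (i : Λ × Λ) :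
    (hΛ.gaborBasis i, hΛ.gaborBasis' i) ∈ fourierGraph χ := by
  rw [gaborBasis_apply, gaborBasis'_apply]
  refine ⟨(integrable_gaborFun hΛ.continuous _ _).congr (coeFn_gabor hΛ.continuous _ _).symm, ?_⟩
  filter_upwards [coeFn_gabor hΛ.continuous (i.2 : K) (-i.1)] with ξ h
  rw [h, ← hΛ.integral_gaborFun_mul i.1.2 i.2.2]
  refine integral_congr_ae ?_
  filter_upwards [coeFn_gabor hΛ.continuous (i.1 : K) i.2] with x hx
  exact congrArg (fun z => z * conj (χ (ξ * x) : ℂ)) hx.symm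

/-- By Fubini, pairing the Fourier integral of `f` with a transformed atom amounts to pairing `f`
with the atom itself, since that atom's transform is known explicitly. -/
theorem IsDualLattice.fourier_eq_of_mem_fourierGraph (hΛ : IsDualLattice ϖ χ Λ) {f g : L2 K}
    (h : (f, g) ∈ fourierGraph χ) : hΛ.fourier f = g := by
  have := hΛ.secondCountableTopology
  obtain ⟨hf, hg⟩ := h
  rw [fourier_eq_iff]
  rintro ⟨⟨a, ha⟩, ⟨b, hb⟩⟩
  rw [gaborBasis_apply, gaborBasis'_apply, L2.inner_def, L2.inner_def]
  have h1 : ∫ x, inner ℂ (gabor hΛ.continuous a b x) (f x) ∂(haar K)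
      = ∫ x, f x * conj (gaborFun χ a b x) ∂(haar K) := by
    refine integral_congr_ae ?_
    filter_upwards [coeFn_gabor hΛ.continuous a b] with x hx
    rw [hx, RCLike.inner_apply]
  have h2 : ∫ ξ, inner ℂ (gabor hΛ.continuous b (-a) ξ) (g ξ) ∂(haar K)
      = ∫ ξ, ∫ x, f x * conj (χ (ξ * x) : ℂ) * conj (gaborFun χ b (-a) ξ) ∂(haar K) ∂(haar K) := by
    refine integral_congr_ae ?_
    filter_upwards [coeFn_gabor hΛ.continuous b (-a), hg] with ξ hξ hgξ
    rw [hξ, RCLike.inner_apply, integral_mul_const]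
    exact congrArg (fun z => z * conj (gaborFun χ b (-a) ξ)) hgξ
  have h3 (x : K) : ∫ ξ, f x * conj (χ (ξ * x) : ℂ) * conj (gaborFun χ b (-a) ξ) ∂(haar K)
      = f x * conj (gaborFun χ a b x) := by
    have e (ξ : K) : f x * conj (χ (ξ * x) : ℂ) * conj (gaborFun χ b (-a) ξ)
        = f x * conj (gaborFun χ b (-a) ξ * conj (χ (-x * ξ) : ℂ)) := by
      rw [neg_mul, coe_char_neg, Complex.conj_conj, RingHom.map_mul, mul_comm ξ x]
      ring
    simp_rw [e]
    rw [integral_const_mul, integral_conj, hΛ.integral_gaborFun_mul hb (Λ.neg_mem ha)]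
    congr 2
    rw [gaborFun, gaborFun, neg_mul_neg]
    congr 1
    have : -x - -a = -(x - a) := by ring
    rw [this]
    exact indicator_one_congr neg_mem_integerBall
  refine h1.trans (Eq.trans ?_ h2.symm)
  rw [integral_integral_swap]
  · simp_rw [h3]
  · have hp := (integrable_gaborFun hΛ.continuous b (-a)).mul_prod hf
    have hc : Continuous fun z : K × K => conj (χ (z.1 * z.2) : ℂ) :=
      Complex.continuous_conj.comp
        (continuous_subtype_val.comp (hΛ.continuous.comp (by fun_prop)))
    have hq := (integrable_gaborFun hΛ.continuous b (-a))
    have hp' : Integrable (fun z : K × K => conj (gaborFun χ b (-a) z.1) * f z.2)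
        ((haar K).prod (haar K)) :=
      ((LinearIsometryEquiv.integrable_comp_iff Complex.conjLIE).2 hq).mul_prod hf
    have := hp'.mul_bdd (c := 1) hc.aestronglyMeasurable (Eventually.of_forall fun z => by
      rw [RCLike.norm_conj, Circle.norm_coe])
    refine this.congr (Eventually.of_forall fun z => ?_)
    simp only [Function.uncurry]
    ring

/-- The graph of a continuous operator is closed, so it contains the closure of the graph on L¹ ∩
L². -/
theorem IsDualLattice.fourier_eq_of_isFourierTransform (hΛ : IsDualLattice ϖ χ Λ) {f g : L2 K}
    (h : IsFourierTransform χ f g) : hΛ.fourier f = g := by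
  have h' : (f, g) ∈ closure (fourierGraph χ) := h
  obtain ⟨U, hU⟩ : ∃ U : L2 K → L2 K, U = hΛ.fourier := ⟨_, rfl⟩
  have hUc : Continuous U := by rw [hU]; exact hΛ.fourier.continuous
  have hc : IsClosed {ab : L2 K × L2 K | U ab.1 = ab.2} :=
    isClosed_eq (hUc.comp continuous_fst) continuous_snd
  have hsub : fourierGraph χ ⊆ {ab : L2 K × L2 K | U ab.1 = ab.2} := fun ab hab => by
    rw [hU]; exact hΛ.fourier_eq_of_mem_fourierGraph hab
  have := closure_minimal hsub hc h'
  rw [hU] at this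
  exact this

theorem affine_mem_fourierGraph (hχ : Continuous χ) (a : Kˣ) (b : K) {f g : L2 K}
    (h : (f, g) ∈ fourierGraph χ) :
    (affine a b f, dilationFactor a • modulate hχ ((a : K)⁻¹ * b) (affine a⁻¹ 0 g))
      ∈ fourierGraph χ := by
  obtain ⟨hf, hg⟩ := h
  refine ⟨(integrable_comp_affine a b hf).congr (coeFn_affine a b f).symm, ?_⟩
  have hg' := (quasiMeasurePreserving_affine a⁻¹ 0).ae hg
  filter_upwards [Lp.coeFn_smul (dilationFactor a)
    (modulate hχ ((a : K)⁻¹ * b) (affine a⁻¹ 0 g)),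
    coeFn_modulate hχ ((a : K)⁻¹ * b) (affine a⁻¹ 0 g), coeFn_affine a⁻¹ 0 g, hg'] with ξ h1 h2 h3 h4
  rw [sub_zero] at h4 h3
  refine h1.trans ?_
  rw [Pi.smul_apply, h2, h3, smul_eq_mul]
  obtain ⟨F, hF⟩ : ∃ F : K → ℂ, ∀ y, F y = f y * conj (χ (ξ * ((a : K)⁻¹ * (y + b))) : ℂ) :=
    ⟨_, fun _ => rfl⟩
  have h5 : ∫ x, affine a b f x * conj (χ (ξ * x) : ℂ) ∂(haar K)
      = ∫ x, F ((a : K) * x - b) ∂(haar K) := by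
    refine integral_congr_ae ?_
    filter_upwards [coeFn_affine a b f] with x hx
    rw [hx]
    have : (a : K)⁻¹ * ((a : K) * x - b + b) = x := by
      rw [sub_add_cancel, inv_mul_cancel_left₀ a.ne_zero]
    rw [hF, this]
  refine Eq.trans ?_ (h5.trans (integral_comp_affine a b F)).symm
  congr 1
  refine (congrArg (fun z : ℂ => conj (χ ((a : K)⁻¹ * b * ξ) : ℂ) * z) h4).trans ?_
  rw [← integral_const_mul]
  refine integral_congr_ae (Eventually.of_forall fun y => ?_)
  have e : ξ * ((a : K)⁻¹ * (y + b)) = (a : K)⁻¹ * b * ξ + (a : K)⁻¹ * ξ * y := by ring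
  simp only [hF, e, AddChar.map_add_eq_mul, Circle.coe_mul, RingHom.map_mul, Units.val_inv_eq_inv_val]
  ring

/-- The Fourier transform of `x ↦ f(a x - b)`. -/
theorem IsDualLattice.fourier_affine (hΛ : IsDualLattice ϖ χ Λ) (a : Kˣ) (b : K) (f : L2 K) :
    hΛ.fourier (affine a b f) = dilationFactor a •
      modulate hΛ.continuous ((a : K)⁻¹ * b) (affine a⁻¹ 0 (hΛ.fourier f)) := by
  let T₁ : L2 K →L[ℂ] L2 K :=
    (hΛ.fourier.toContinuousLinearEquiv : L2 K →L[ℂ] L2 K).comp (affineCLM a b)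
  let T₂ : L2 K →L[ℂ] L2 K := dilationFactor a •
    (modulate hΛ.continuous ((a : K)⁻¹ * b)).comp ((affineCLM a⁻¹ 0).comp
      (hΛ.fourier.toContinuousLinearEquiv : L2 K →L[ℂ] L2 K))
  suffices h : T₁ = T₂ from congrArg (fun T : L2 K →L[ℂ] L2 K => T f) h
  -- Both sides are bounded operators; comparing them on Gabor atoms, where the integral formula
  -- applies, is enough.
  refine ContinuousLinearMap.ext_on (s := Set.range hΛ.gaborBasis) ?_ ?_
  · rw [Submodule.dense_iff_topologicalClosure_eq_top]
    exact hΛ.gaborBasis.dense_span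
  · rintro _ ⟨i, rfl⟩
    have h := hΛ.fourier_eq_of_mem_fourierGraph
      (affine_mem_fourierGraph hΛ.continuous a b (hΛ.gaborBasis_mem_fourierGraph i))
    rw [← fourier_gaborBasis] at h
    exact h

theorem IsDualLattice.coeFn_fourier_affine (hΛ : IsDualLattice ϖ χ Λ) (a : Kˣ) (b : K)
    (f : L2 K) : hΛ.fourier (affine a b f) =ᵐ[haar K] fun ξ =>
      dilationFactor a * (conj (χ ((a : K)⁻¹ * b * ξ) : ℂ) *
        hΛ.fourier f ((a : K)⁻¹ * ξ)) := by
  rw [hΛ.fourier_affine]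
  filter_upwards [Lp.coeFn_smul (dilationFactor a)
    (modulate hΛ.continuous ((a : K)⁻¹ * b) (affine a⁻¹ 0 (hΛ.fourier f))),
    coeFn_modulate hΛ.continuous ((a : K)⁻¹ * b) (affine a⁻¹ 0 (hΛ.fourier f)),
    coeFn_affine a⁻¹ 0 (hΛ.fourier f)] with ξ h1 h2 h3
  rw [h1, Pi.smul_apply, h2, h3, sub_zero, Units.val_inv_eq_inv_val, smul_eq_mul]

end Fourier

end LocalFieldWavelet

end

noncomputable section

namespace LocalFieldWavelet

/-! ### Closed spans in Hilbert spaces. -/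

section Hilbert

variable {H ι : Type*} [NormedAddCommGroup H] [InnerProductSpace ℂ H] [CompleteSpace H]

/-- A vector orthogonal to the elements of an orthonormal basis outside `A` lies in the closed span
of the elements in `A`. -/
theorem mem_topologicalClosure_span_image {e : ι → H} (he : Orthonormal ℂ e)
    (hs : (Submodule.span ℂ (Set.range e)).topologicalClosure = ⊤) (A : Set ι) {f : H}
    (hf : ∀ i, i ∉ A → inner ℂ (e i) f = 0) :
    f ∈ (Submodule.span ℂ (e '' A)).topologicalClosure := by
  let b := HilbertBasis.mk he hs.ge
  have hb (i : ι) : b i = e i := by rw [HilbertBasis.coe_mk]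
  have hsum := b.hasSum_repr f
  refine (Submodule.isClosed_topologicalClosure _).mem_of_tendsto hsum
    (Eventually.of_forall fun s => ?_)
  refine Submodule.sum_mem _ fun i _ => ?_
  by_cases hi : i ∈ A
  · exact Submodule.smul_mem _ _ (Submodule.le_topologicalClosure _
      (Submodule.subset_span ⟨i, hi, (hb i).symm⟩))
  · rw [b.repr_apply_apply, hb, hf i hi, zero_smul]
    exact Submodule.zero_mem _

theorem eq_zero_of_inner_eq_zero {e : ι → H}
    (hs : (Submodule.span ℂ (Set.range e)).topologicalClosure = ⊤) {f : H}
    (hf : ∀ i, inner ℂ (e i) f = 0) : f = 0 := by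
  have h : f ∈ (Submodule.span ℂ (Set.range e))ᗮ := by
    rw [Submodule.mem_orthogonal]
    intro v hv
    induction hv using Submodule.span_induction with
    | mem x hx => obtain ⟨i, rfl⟩ := hx; exact hf i
    | zero => simp
    | add x y _ _ hx hy => rw [inner_add_left, hx, hy, add_zero]
    | smul c x _ hx => rw [inner_smul_left, hx, mul_zero]
  rw [← Submodule.orthogonal_closure, hs, Submodule.top_orthogonal_eq_bot] at h
  exact h

/-- A closed subspace is the closed span of a family of its elements when it contains no nonzero
vector orthogonal to all of them. -/
theorem topologicalClosure_span_eq {e : ι → H} {V : Submodule ℂ H} (hV : IsClosed (V : Set H))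
    (he : ∀ i, e i ∈ V) (h : ∀ f ∈ V, (∀ i, inner ℂ (e i) f = 0) → f = 0) :
    (Submodule.span ℂ (Set.range e)).topologicalClosure = V := by
  set M := (Submodule.span ℂ (Set.range e)).topologicalClosure with hM
  have hle : M ≤ V := Submodule.topologicalClosure_minimal _
    (Submodule.span_le.2 (by rintro _ ⟨i, rfl⟩; exact he i)) hV
  have : CompleteSpace M := (Submodule.isClosed_topologicalClosure _).completeSpace_coe
  have h2 := Submodule.sup_orthogonal_inf_of_hasOrthogonalProjection hle
  have h3 : Mᗮ ⊓ V = ⊥ := by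
    rw [Submodule.eq_bot_iff]
    rintro f ⟨hf1, hf2⟩
    refine h f hf2 fun i => ?_
    exact (Submodule.mem_orthogonal _ _).1 hf1 _
      (Submodule.le_topologicalClosure _ (Submodule.subset_span ⟨i, rfl⟩))
  rwa [h3, sup_bot_eq] at h2

end Hilbert

variable {K : Type*} [Field K] [ValuativeRel K] [TopologicalSpace K]
  [IsNonarchimedeanLocalField K] [MeasurableSpace K] [BorelSpace K]
  {ϖ : Kˣ} {χ : AddChar K Circle} {Λ : AddSubgroup K}

/-! ### Functions with prescribed Fourier support. -/

section Bandlimited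

/-- The functions in `L²(K)` whose Fourier transform vanishes outside `A`. -/
def IsDualLattice.bandlimited (hΛ : IsDualLattice ϖ χ Λ) (A : Set K) : Submodule ℂ (L2 K) :=
  ((LpToLpRestrictCLM K ℂ ℂ (haar K) 2 Aᶜ).comp
    (hΛ.fourier.toContinuousLinearEquiv : L2 K →L[ℂ] L2 K)).ker

theorem IsDualLattice.isClosed_bandlimited (hΛ : IsDualLattice ϖ χ Λ) (A : Set K) :
    IsClosed (hΛ.bandlimited A : Set (L2 K)) :=
  ContinuousLinearMap.isClosed_ker _

theorem IsDualLattice.mem_bandlimited (hΛ : IsDualLattice ϖ χ Λ) {A : Set K}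
    (hA : MeasurableSet A) (f : L2 K) :
    f ∈ hΛ.bandlimited A ↔ ∀ᵐ ξ ∂(haar K), ξ ∉ A → hΛ.fourier f ξ = 0 := by
  have h1 : f ∈ hΛ.bandlimited A ↔
      LpToLpRestrictCLM K ℂ ℂ (haar K) 2 Aᶜ (hΛ.fourier f) = 0 := Iff.rfl
  have h2 := LpToLpRestrictCLM_coeFn (μ := haar K) (p := 2) ℂ Aᶜ (hΛ.fourier f)
  have h3 : (∀ᵐ ξ ∂(haar K), ξ ∉ A → hΛ.fourier f ξ = 0) ↔
      ∀ᵐ ξ ∂(haar K).restrict Aᶜ, hΛ.fourier f ξ = 0 := (ae_restrict_iff' hA.compl).symm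
  rw [h1, h3, Lp.eq_zero_iff_ae_eq_zero]
  constructor
  · intro h
    filter_upwards [h, h2] with ξ h4 h5
    rw [← h5, h4]; rfl
  · intro h
    filter_upwards [h, h2] with ξ h4 h5
    rw [h5, h4]; rfl

theorem IsDualLattice.inner_eq_zero_of_bandlimited (hΛ : IsDualLattice ϖ χ Λ) {A B : Set K}
    (hA : MeasurableSet A) (hB : MeasurableSet B) (hAB : haar K (A ∩ B) = 0) {f g : L2 K}
    (hf : f ∈ hΛ.bandlimited A) (hg : g ∈ hΛ.bandlimited B) : inner ℂ f g = 0 := by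
  rw [← hΛ.fourier.inner_map_map, L2.inner_def]
  refine integral_eq_zero_of_ae ?_
  have hn : ∀ᵐ ξ ∂(haar K), ξ ∉ A ∩ B := measure_eq_zero_iff_ae_notMem.1 hAB
  filter_upwards [(hΛ.mem_bandlimited hA f).1 hf, (hΛ.mem_bandlimited hB g).1 hg, hn]
    with ξ h1 h2 h3
  by_cases hξ : ξ ∈ A
  · rw [h2 fun h => h3 ⟨hξ, h⟩, inner_zero_right]; rfl
  · rw [h1 hξ, inner_zero_left]; rfl

theorem ae_comp_affine {P : K → Prop} (a : Kˣ) (b : K) (h : ∀ᵐ x ∂(haar K), P x) :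
    ∀ᵐ x ∂(haar K), P ((a : K) * x - b) :=
  (quasiMeasurePreserving_affine a b).ae h

theorem ae_comp_mul_iff {P : K → Prop} (a : Kˣ) :
    (∀ᵐ x ∂(haar K), P ((a : K) * x)) ↔ ∀ᵐ x ∂(haar K), P x := by
  constructor
  · intro h
    have := ae_comp_affine (P := fun x => P ((a : K) * x)) a⁻¹ 0 h
    simpa using this
  · intro h
    simpa using ae_comp_affine (P := P) a 0 h

/-- The dilation turns f̂ into a nonzero multiple of ξ ↦ f̂(aξ). This becomes the dilation axiom of
the MRA. -/
theorem IsDualLattice.affine_mem_bandlimited_iff (hΛ : IsDualLattice ϖ χ Λ) {A : Set K}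
    (hA : MeasurableSet A) (a : Kˣ) (f : L2 K) :
    affine a⁻¹ 0 f ∈ hΛ.bandlimited {ξ | (a : K) * ξ ∈ A} ↔ f ∈ hΛ.bandlimited A := by
  have hm : MeasurableSet {ξ | (a : K) * ξ ∈ A} :=
    hA.preimage (f := fun ξ => (a : K) * ξ) (by fun_prop)
  rw [hΛ.mem_bandlimited hm, hΛ.mem_bandlimited hA,
    ← ae_comp_mul_iff (P := fun ξ => ξ ∉ A → hΛ.fourier f ξ = 0) a]
  refine eventually_congr ?_
  filter_upwards [hΛ.coeFn_fourier_affine a⁻¹ 0 f] with ξ h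
  rw [h]
  simp [dilationFactor_ne_zero]

end Bandlimited

/-! ### Dilates and the scaling set. -/

section Dilates

/-- The dilated set `ϖ ^ (-j) W`. -/
def dilate (ϖ : Kˣ) (j : ℤ) (W : Set K) : Set K := {ξ | (ϖ : K) ^ j * ξ ∈ W}

theorem measurableSet_dilate {W : Set K} (hW : MeasurableSet W) (j : ℤ) :
    MeasurableSet (dilate ϖ j W) :=
  hW.preimage (f := fun ξ => (ϖ : K) ^ j * ξ) (by fun_prop)

/-- The set `⋃ ϖ ^ (-i) W_l` over all `l` and all `i < j`. -/
def scalingSet (ϖ : Kˣ) {L : ℕ} (W : Fin L → Set K) (j : ℤ) : Set K :=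
  -- At `j = 0` the pieces are ϖ^{n+1}W_l, the sets of the covering criterion.
  ⋃ l, ⋃ n : ℕ, dilate ϖ (j - 1 - n) (W l)

theorem mem_scalingSet {L : ℕ} {W : Fin L → Set K} {j : ℤ} {ξ : K} :
    ξ ∈ scalingSet ϖ W j ↔ ∃ l, ∃ i < j, (ϖ : K) ^ i * ξ ∈ W l := by
  simp only [scalingSet, Set.mem_iUnion]
  constructor
  · rintro ⟨l, n, h⟩
    exact ⟨l, j - 1 - n, by omega, h⟩
  · rintro ⟨l, i, hi, h⟩
    refine ⟨l, (j - 1 - i).toNat, ?_⟩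
    rwa [Int.toNat_of_nonneg (by omega), sub_sub_cancel]

theorem measurableSet_scalingSet {L : ℕ} {W : Fin L → Set K} (hW : ∀ l, MeasurableSet (W l))
    (j : ℤ) : MeasurableSet (scalingSet ϖ W j) :=
  .iUnion fun l => .iUnion fun _ => measurableSet_dilate (hW l) _

theorem dilate_subset_scalingSet {L : ℕ} (W : Fin L → Set K) (l : Fin L) {i j : ℤ} (h : i < j) :
    dilate ϖ i (W l) ⊆ scalingSet ϖ W j :=
  fun _ hξ => mem_scalingSet.2 ⟨l, i, h, hξ⟩

theorem scalingSet_mono {L : ℕ} (W : Fin L → Set K) {i j : ℤ} (h : i ≤ j) :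
    scalingSet ϖ W i ⊆ scalingSet ϖ W j := by
  intro ξ hξ
  obtain ⟨l, k, hk, hξ⟩ := mem_scalingSet.1 hξ
  exact mem_scalingSet.2 ⟨l, k, hk.trans_le h, hξ⟩

theorem scalingSet_add_one {L : ℕ} (W : Fin L → Set K) (j : ℤ) :
    {ξ | (ϖ : K) * ξ ∈ scalingSet ϖ W j} = scalingSet ϖ W (j + 1) := by
  ext ξ
  simp only [Set.mem_ofPred_eq, mem_scalingSet]
  constructor
  · rintro ⟨l, i, hi, h⟩
    refine ⟨l, i + 1, by omega, ?_⟩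
    rwa [zpow_add_one₀ ϖ.ne_zero, mul_assoc]
  · rintro ⟨l, i, hi, h⟩
    refine ⟨l, i - 1, by omega, ?_⟩
    rwa [← mul_assoc, ← zpow_add_one₀ ϖ.ne_zero, sub_add_cancel]

end Dilates

/-- `ψ` is a multiwavelet with Fourier transforms `1_{W_l}`, with translations by an enumeration
`u` of `Λ`. -/
structure IsDualLattice.IsIndicatorMultiwavelet (hΛ : IsDualLattice ϖ χ Λ) (q : ℕ) (u : ℕ → K)
    {L : ℕ} (W : Fin L → Set K) (ψ : Fin L → L2 K) : Prop where
  one_lt : 1 < q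
  injective : Function.Injective u
  range : (Λ : Set K) = Set.range u
  measurableSet : ∀ l, MeasurableSet (W l)
  fourier : ∀ l, hΛ.fourier (ψ l) =ᵐ[haar K] (W l).indicator 1
  multiwavelet : IsMultiwavelet q ϖ u ψ

/-! ### Measures and almost disjointness of the dilated wavelet sets. -/

section Wavelets

variable {hΛ : IsDualLattice ϖ χ Λ} {q : ℕ} {u : ℕ → K} {L : ℕ} {W : Fin L → Set K}
  {ψ : Fin L → L2 K}

theorem waveletElement_zero (q : ℕ) (ϖ : Kˣ) (u : ℕ → K) (f : L2 K) (t : ℕ) :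
    waveletElement q ϖ u f 0 t = affine 1 (u t) f := by
  simp [waveletElement]

/-- Proportionality is all that is needed to carry orthogonality from one scale to the next. -/
theorem waveletElement_add_one (q : ℕ) (ϖ : Kˣ) (u : ℕ → K) (f : L2 K) (j : ℤ) (t : ℕ)
    (hq : 0 < q) : ∃ c : ℂ, waveletElement q ϖ u f (j + 1) t
      = c • affine ϖ⁻¹ 0 (waveletElement q ϖ u f j t) := by
  refine ⟨(((q : ℝ) ^ (((j + 1 : ℤ) : ℝ) / 2) : ℝ) : ℂ) *
    ((((q : ℝ) ^ ((j : ℝ) / 2) : ℝ) : ℂ))⁻¹, ?_⟩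
  have h0 : (((q : ℝ) ^ ((j : ℝ) / 2) : ℝ) : ℂ) ≠ 0 := by
    rw [Complex.ofReal_ne_zero]; positivity
  rw [waveletElement, waveletElement, affine_smul, affine_affine, smul_smul, mul_assoc,
    inv_mul_cancel₀ h0, mul_one, mul_zero, zero_add]
  congr 2
  rw [neg_add, zpow_add, zpow_neg_one]

namespace IsDualLattice.IsIndicatorMultiwavelet

/-- The Fourier transform of `ψ_{j,t}`. -/
theorem coeFn_fourier_waveletElement (h : hΛ.IsIndicatorMultiwavelet q u W ψ) (l : Fin L) (j : ℤ) :
    ∃ c : ℂ, c ≠ 0 ∧ ∀ t, hΛ.fourier (waveletElement q ϖ u (ψ l) j t) =ᵐ[haar K] fun ξ =>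
      c * (conj (χ ((ϖ : K) ^ j * u t * ξ) : ℂ) * (dilate ϖ j (W l)).indicator 1 ξ) := by
  have hq : 0 < q := by have := h.one_lt; omega
  have h0 : (((q : ℝ) ^ ((j : ℝ) / 2) : ℝ) : ℂ) ≠ 0 := by
    rw [Complex.ofReal_ne_zero]; positivity
  refine ⟨_, mul_ne_zero h0 (dilationFactor_ne_zero (ϖ ^ (-j))), fun t => ?_⟩
  rw [waveletElement, map_smul]
  have hv : (((ϖ ^ (-j) : Kˣ) : K))⁻¹ = (ϖ : K) ^ j := by
    rw [Units.val_zpow_eq_zpow_val, zpow_neg, inv_inv]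
  have hv' : ((ϖ ^ j : Kˣ) : K) = (ϖ : K) ^ j := Units.val_zpow_eq_zpow_val ϖ j
  have hf := ae_comp_affine (P := fun ξ => hΛ.fourier (ψ l) ξ = (W l).indicator 1 ξ) (ϖ ^ j) 0
    (h.fourier l)
  filter_upwards [Lp.coeFn_smul (((q : ℝ) ^ ((j : ℝ) / 2) : ℝ) : ℂ)
    (hΛ.fourier (affine (ϖ ^ (-j)) (u t) (ψ l))),
    hΛ.coeFn_fourier_affine (ϖ ^ (-j)) (u t) (ψ l), hf] with ξ h1 h2 h3
  rw [sub_zero, hv'] at h3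
  have hd : (dilate ϖ j (W l)).indicator (1 : K → ℂ) ξ
      = (W l).indicator 1 ((ϖ : K) ^ j * ξ) := rfl
  rw [h1, Pi.smul_apply, h2, hv, h3, smul_eq_mul, hd, mul_assoc (((q : ℝ) ^ _ : ℝ) : ℂ)]

theorem waveletElement_mem_bandlimited (h : hΛ.IsIndicatorMultiwavelet q u W ψ) (l : Fin L)
    (j : ℤ) (t : ℕ) :
    waveletElement q ϖ u (ψ l) j t ∈ hΛ.bandlimited (dilate ϖ j (W l)) := by
  rw [hΛ.mem_bandlimited (measurableSet_dilate (h.measurableSet l) j)]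
  obtain ⟨c, -, hc⟩ := h.coeFn_fourier_waveletElement l j
  filter_upwards [hc t] with ξ h1 h2
  rw [h1, Set.indicator_of_notMem h2, mul_zero, mul_zero]

theorem exists_eq_zero (h : hΛ.IsIndicatorMultiwavelet q u W ψ) : ∃ t, u t = 0 := by
  have : (0 : K) ∈ (Λ : Set K) := Λ.zero_mem
  rw [h.range] at this
  exact this

theorem mem (h : hΛ.IsIndicatorMultiwavelet q u W ψ) (t : ℕ) : u t ∈ Λ := by
  rw [← SetLike.mem_coe, h.range]
  exact ⟨t, rfl⟩

theorem orthonormal (h : hΛ.IsIndicatorMultiwavelet q u W ψ) :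
    Orthonormal ℂ fun i : Fin L × ℤ × ℕ => waveletElement q ϖ u (ψ i.1) i.2.1 i.2.2 :=
  h.multiwavelet.1

theorem norm_eq_one (h : hΛ.IsIndicatorMultiwavelet q u W ψ) (l : Fin L) : ‖ψ l‖ = 1 := by
  obtain ⟨t, ht⟩ := h.exists_eq_zero
  have := h.orthonormal.1 (l, 0, t)
  simp only [waveletElement_zero, ht, affine_one_zero] at this
  exact this

/-- By Plancherel the measure is the squared norm of `ψ l`, itself a member of the orthonormal
system. -/
theorem haar_eq_one (h : hΛ.IsIndicatorMultiwavelet q u W ψ) (l : Fin L) :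
    haar K (W l) = 1 := by
  have h1 : ‖hΛ.fourier (ψ l)‖ = 1 := by rw [hΛ.fourier.norm_map, h.norm_eq_one]
  have h2 : eLpNorm (hΛ.fourier (ψ l)) 2 (haar K) = 1 := by
    rw [Lp.norm_def] at h1
    rw [← ENNReal.toReal_eq_one_iff]
    exact h1
  rw [eLpNorm_congr_ae (h.fourier l)] at h2
  have h3 : (W l).indicator (1 : K → ℂ) = (W l).indicator fun _ => 1 := rfl
  rw [h3, eLpNorm_indicator_const (h.measurableSet l) (by norm_num) (by norm_num)] at h2
  simp only [enorm_one, one_mul] at h2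
  have h4 := congrArg (fun x : ℝ≥0∞ => x ^ (2 : ℝ)) h2
  simp only [← ENNReal.rpow_mul, ENNReal.one_rpow] at h4
  simpa using h4

/-- Forced by the factor q^{1/2}: ψ_{1,t} has norm 1, which fixes the scaling of Haar measure
without counting residue classes. -/
theorem modulus_eq (h : hΛ.IsIndicatorMultiwavelet q u W ψ) (l : Fin L) :
    modulus ϖ = (q : NNReal)⁻¹ := by
  have hq : 0 < q := by have := h.one_lt; omega
  obtain ⟨t, ht⟩ := h.exists_eq_zero
  have h1 := h.orthonormal.1 (l, 1, t)
  simp only [waveletElement] at h1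
  have h2 : ‖affine (ϖ ^ (-1 : ℤ)) (u t) (ψ l)‖ ^ 2 = modulus ϖ := by
    rw [norm_affine, h.norm_eq_one, mul_one, Real.sq_sqrt (by positivity), zpow_neg_one,
      modulus_inv, inv_inv]
  have h3 : (q : ℝ) * modulus ϖ = 1 := by
    have := congrArg (fun x : ℝ => x ^ 2) h1
    simp only [norm_smul, mul_pow, one_pow] at this
    rw [h2, Complex.norm_real, Real.norm_of_nonneg (by positivity), ← Real.rpow_natCast,
      ← Real.rpow_mul (by positivity)] at this
    simpa using this
  have h4 : (q : NNReal) * modulus ϖ = 1 := by exact_mod_cast h3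
  exact eq_inv_of_mul_eq_one_right h4

theorem haar_dilate (h : hΛ.IsIndicatorMultiwavelet q u W ψ) (l : Fin L) (n : ℕ) :
    haar K (dilate ϖ (0 - 1 - n) (W l)) = ((q : ℝ≥0∞)⁻¹) ^ (n + 1) := by
  have hq : (q : NNReal) ≠ 0 := by have := h.one_lt; exact_mod_cast (by omega : q ≠ 0)
  have e : dilate ϖ (0 - 1 - n) (W l) = (fun x => (((ϖ ^ (n + 1))⁻¹ : Kˣ) : K) * x) ⁻¹' W l := by
    ext ξ
    have : (ϖ : K) ^ (0 - 1 - n : ℤ) = (((ϖ ^ (n + 1))⁻¹ : Kˣ) : K) := by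
      rw [show (0 - 1 - n : ℤ) = -((n + 1 : ℕ) : ℤ) by push_cast; ring, zpow_neg, zpow_natCast]
      simp
    rw [← this]; rfl
  rw [e, haar_preimage_mul, h.haar_eq_one, mul_one, modulus_inv, inv_inv, modulus_pow,
    h.modulus_eq l, ENNReal.coe_pow, ENNReal.coe_inv hq]
  simp

theorem haar_dilate_ne_top (h : hΛ.IsIndicatorMultiwavelet q u W ψ) (l : Fin L) (j : ℤ) :
    haar K (dilate ϖ j (W l)) ≠ ∞ := by
  have e : dilate ϖ j (W l) = (fun x => ((ϖ ^ j : Kˣ) : K) * x) ⁻¹' W l := by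
    ext ξ
    rw [Units.val_zpow_eq_zpow_val]; rfl
  rw [e, haar_preimage_mul, h.haar_eq_one, mul_one]
  exact ENNReal.coe_ne_top

/-- The sets `ϖ ^ (-j) W_l` are pairwise almost disjoint. -/
theorem haar_dilate_inter (h : hΛ.IsIndicatorMultiwavelet q u W ψ) {l l' : Fin L} {j j' : ℤ}
    (hne : (l, j) ≠ (l', j')) : haar K (dilate ϖ j (W l) ∩ dilate ϖ j' (W l')) = 0 := by
  obtain ⟨t, ht⟩ := h.exists_eq_zero
  -- At translation `u t = 0` the modulations disappear, and the inner product is a nonzero multiple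
  -- of the measure of the intersection.
  have h1 := h.orthonormal.2 (i := (l, j, t)) (j := (l', j', t)) fun he =>
      hne (Prod.ext (congrArg (fun x => x.1) he) (congrArg (fun x => x.2.1) he))
  simp only at h1
  obtain ⟨c, hc0, hc⟩ := h.coeFn_fourier_waveletElement l j
  obtain ⟨c', hc0', hc'⟩ := h.coeFn_fourier_waveletElement l' j'
  rw [← hΛ.fourier.inner_map_map, L2.inner_def] at h1
  have hm : MeasurableSet (dilate ϖ j (W l) ∩ dilate ϖ j' (W l')) :=
    (measurableSet_dilate (h.measurableSet l) j).inter (measurableSet_dilate (h.measurableSet l') j')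
  have h2 : ∫ ξ, inner ℂ (hΛ.fourier (waveletElement q ϖ u (ψ l) j t) ξ)
        (hΛ.fourier (waveletElement q ϖ u (ψ l') j' t) ξ) ∂(haar K)
      = ∫ ξ, (c' * conj c) *
        (dilate ϖ j (W l) ∩ dilate ϖ j' (W l')).indicator 1 ξ ∂(haar K) := by
    refine integral_congr_ae ?_
    filter_upwards [hc t, hc' t] with ξ h3 h4
    rw [h3, h4, ht, RCLike.inner_apply]
    simp only [mul_zero, zero_mul, AddChar.map_zero_eq_one, Circle.coe_one, map_one, one_mul]
    rw [Set.inter_indicator_one]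
    simp only [RingHom.map_mul, Pi.mul_apply]
    by_cases hξ : ξ ∈ dilate ϖ j (W l) <;> simp [hξ]
    ring
  rw [h2, integral_const_mul, integral_indicator hm] at h1
  have h5 := (mul_eq_zero.1 h1).resolve_left
    (mul_ne_zero hc0' ((map_ne_zero_iff _ (RingHom.injective _)).2 hc0))
  simp only [Pi.one_apply, integral_const, measureReal_restrict_apply_univ, Complex.real_smul,
    mul_one, Complex.ofReal_eq_zero] at h5
  rw [Measure.real, ENNReal.toReal_eq_zero_iff] at h5
  exact h5.resolve_right
    (ne_top_of_le_ne_top (h.haar_dilate_ne_top l j) (measure_mono Set.inter_subset_left))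

theorem haar_dilate_inter_scalingSet (h : hΛ.IsIndicatorMultiwavelet q u W ψ) (l : Fin L)
    {i j : ℤ} (hij : j ≤ i) : haar K (dilate ϖ i (W l) ∩ scalingSet ϖ W j) = 0 := by
  rw [scalingSet, Set.inter_iUnion]
  refine measure_iUnion_null fun l' => ?_
  rw [Set.inter_iUnion]
  refine measure_iUnion_null fun n => h.haar_dilate_inter ?_
  simp only [ne_eq, Prod.mk.injEq, not_and]
  intro _
  omega

theorem waveletElement_mem_bandlimited_scalingSet (h : hΛ.IsIndicatorMultiwavelet q u W ψ)
    (l : Fin L) {i j : ℤ} (hij : i < j) (t : ℕ) :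
    waveletElement q ϖ u (ψ l) i t ∈ hΛ.bandlimited (scalingSet ϖ W j) := by
  have h1 := h.waveletElement_mem_bandlimited l i t
  rw [hΛ.mem_bandlimited (measurableSet_dilate (h.measurableSet l) i)] at h1
  rw [hΛ.mem_bandlimited (measurableSet_scalingSet h.measurableSet j)]
  filter_upwards [h1] with ξ h2 h3
  exact h2 fun h4 => h3 (dilate_subset_scalingSet W l hij h4)

theorem inner_waveletElement_eq_zero (h : hΛ.IsIndicatorMultiwavelet q u W ψ) (l : Fin L)
    {i j : ℤ} (hij : j ≤ i) (t : ℕ) {f : L2 K} (hf : f ∈ hΛ.bandlimited (scalingSet ϖ W j)) :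
    inner ℂ (waveletElement q ϖ u (ψ l) i t) f = 0 :=
  hΛ.inner_eq_zero_of_bandlimited (measurableSet_dilate (h.measurableSet l) i)
    (measurableSet_scalingSet h.measurableSet j) (h.haar_dilate_inter_scalingSet l hij)
    (h.waveletElement_mem_bandlimited l i t) hf

/-- Union bound and geometric series; this is where the order q - 1 enters. -/
theorem haar_scalingSet_le (h : hΛ.IsIndicatorMultiwavelet q u W ψ) (hL : L = q - 1) :
    haar K (scalingSet ϖ W 0) ≤ 1 := by
  have hq := h.one_lt
  have hq0 : (q : ℝ≥0∞) ≠ 0 := by exact_mod_cast (by omega : q ≠ 0)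
  calc haar K (scalingSet ϖ W 0)
      ≤ ∑ l : Fin L, haar K (⋃ n : ℕ, dilate ϖ (0 - 1 - n) (W l)) :=
        measure_iUnion_fintype_le _ _
    _ ≤ ∑ l : Fin L, ∑' n : ℕ, haar K (dilate ϖ (0 - 1 - n) (W l)) := by
        gcongr; exact measure_iUnion_le _
    _ = L * ((q : ℝ≥0∞)⁻¹ * (1 - (q : ℝ≥0∞)⁻¹)⁻¹) := by
        simp_rw [h.haar_dilate, ENNReal.tsum_geometric_add_one]
        simp
    _ = 1 := by
        have e : (1 : ℝ≥0∞) - (q : ℝ≥0∞)⁻¹ = L * (q : ℝ≥0∞)⁻¹ := by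
          rw [hL, ENNReal.natCast_sub, Nat.cast_one, ENNReal.sub_mul (by simp [hq0]),
            ENNReal.mul_inv_cancel hq0 (by simp), one_mul]
        rw [← mul_assoc, ← e]
        refine ENNReal.mul_inv_cancel ?_ (by simp)
        rw [e]
        simp
        omega

end IsDualLattice.IsIndicatorMultiwavelet

end Wavelets

end LocalFieldWavelet

end

noncomputable section

namespace LocalFieldWavelet

variable {K : Type*} [Field K] [ValuativeRel K] [TopologicalSpace K]
  [IsNonarchimedeanLocalField K] [MeasurableSpace K] [BorelSpace K]
  {ϖ : Kˣ} {χ : AddChar K Circle} {Λ : AddSubgroup K}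

/-! ### Fundamental domains for Λ and their characters. -/

section Tiling

theorem IsDualLattice.integral_indicator_mul_char_of_mem (hΛ : IsDualLattice ϖ χ Λ) {y : K}
    (hy : y ∈ Λ) [Decidable (y = 0)] :
    ∫ x, (integerBall K).indicator 1 x * (χ (y * x) : ℂ) ∂(haar K) = if y = 0 then 1 else 0 := by
  rw [hΛ.integral_indicator_mul_char]
  have : y ∈ integerBall K ↔ y = 0 := by
    simpa using hΛ.sub_mem_integerBall_iff hy Λ.zero_mem
  split_ifs with h
  · rw [Set.indicator_of_mem (this.2 h)]; rfl
  · rw [Set.indicator_of_notMem (fun h' => h (this.1 h'))]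

/-- A set of measure at most `1` whose translates by `Λ` cover `K` is a fundamental domain. -/
theorem IsDualLattice.isAddFundamentalDomain_of_covers (hΛ : IsDualLattice ϖ χ Λ) {S : Set K}
    (hS : MeasurableSet S) (hS1 : haar K S ≤ 1) (hcov : ∀ᵐ x ∂(haar K), ∃ z : Λ, z +ᵥ x ∈ S) :
    IsAddFundamentalDomain Λ S (haar K) := by
  have : Countable Λ := hΛ.countable.to_subtype
  have hD := hΛ.isAddFundamentalDomain
  -- `F x` counts the points of x + Λ in `S`. Its integral over 𝔇 is |S| ≤ 1, while covering gives
  -- `F ≥ 1`; hence `F = 1` almost everywhere.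
  obtain ⟨F, hF⟩ : ∃ F : K → ℝ≥0∞, ∀ x, F x = ∑' z : Λ, S.indicator 1 (z +ᵥ x) :=
    ⟨_, fun _ => rfl⟩
  have hmz (z : Λ) : Measurable fun x : K => S.indicator (1 : K → ℝ≥0∞) (z +ᵥ x) :=
    (measurable_one.indicator hS).comp (measurable_const_add (z : K))
  have hFm : Measurable F := by
    rw [funext hF]; exact Measurable.tsum hmz
  have hint : ∫⁻ x in integerBall K, F x ∂(haar K) ≤ 1 := by
    simp_rw [hF]
    rw [lintegral_tsum fun z => (hmz z).aemeasurable, ← hD.lintegral_eq_tsum'' (S.indicator 1),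
      lintegral_indicator_one hS]
    exact hS1
  have hge : ∀ᵐ x ∂(haar K), 1 ≤ F x := by
    filter_upwards [hcov] with x ⟨z, hz⟩
    rw [hF]
    refine le_trans ?_ (ENNReal.le_tsum z)
    rw [Set.indicator_of_mem hz]; rfl
  have heq : (fun _ => 1) =ᵐ[(haar K).restrict (integerBall K)] F := by
    refine ae_eq_of_ae_le_of_lintegral_le (ae_restrict_of_ae hge) ?_ hFm.aemeasurable ?_
    · simp [haar_integerBall]
    · simpa [haar_integerBall] using hint
  have hone : ∀ᵐ x ∂(haar K), 1 = F x := by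
    refine hΛ.ae_of_ae_restrict (T := fun x => 1 = F x) (fun w x h => ?_) heq
    rw [h, hF, hF, ← (Equiv.addRight w).tsum_eq fun z : Λ => S.indicator 1 (z +ᵥ x)]
    exact tsum_congr fun z => congrArg (S.indicator 1) (add_vadd z w x).symm
  refine ⟨hS.nullMeasurableSet, hcov, fun a b hab => ?_⟩
  refine measure_mono_null ?_ (ae_iff.1 hone)
  rintro x ⟨⟨y, hy, hyx⟩, ⟨y', hy', hyx'⟩⟩ hx
  have ha : -a +ᵥ x ∈ S := by
    rw [← hyx]
    change -a +ᵥ (a +ᵥ y) ∈ S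
    rwa [neg_vadd_vadd]
  have hb : -b +ᵥ x ∈ S := by
    rw [← hyx']
    change -b +ᵥ (b +ᵥ y') ∈ S
    rwa [neg_vadd_vadd]
  classical
  have h2 : ∑ z ∈ {-a, -b}, S.indicator (1 : K → ℝ≥0∞) (z +ᵥ x) ≤ F x := by
    rw [hF]; exact ENNReal.sum_le_tsum _
  rw [Finset.sum_pair (fun h => hab (neg_injective h)), Set.indicator_of_mem ha,
    Set.indicator_of_mem hb, ← hx] at h2
  norm_num at h2

variable {S : Set K}

/-- The characters in `Λ` are orthonormal on every fundamental domain. -/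
theorem IsDualLattice.integral_indicator_mul_char_of_tile (hΛ : IsDualLattice ϖ χ Λ)
    (hS : MeasurableSet S) (hD : IsAddFundamentalDomain Λ S (haar K)) {y : K} (hy : y ∈ Λ)
    [Decidable (y = 0)] :
    ∫ x, S.indicator 1 x * (χ (y * x) : ℂ) ∂(haar K) = if y = 0 then 1 else 0 := by
  have : Countable Λ := hΛ.countable.to_subtype
  have h1 (A : Set K) (hA : MeasurableSet A) : ∫ x, A.indicator 1 x * (χ (y * x) : ℂ) ∂(haar K)
      = ∫ x in A, (χ (y * x) : ℂ) ∂(haar K) := by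
    rw [← integral_indicator hA]
    refine integral_congr_ae (Eventually.of_forall fun x => ?_)
    by_cases hx : x ∈ A <;> simp [hx]
  rw [← hΛ.integral_indicator_mul_char_of_mem hy, h1 S hS, h1 _ measurableSet_integerBall]
  -- A Λ-periodic function has the same integral over any two fundamental domains.
  exact hD.setIntegral_eq hΛ.isAddFundamentalDomain fun z x =>
    congrArg _ (hΛ.map_mul_vadd hy z x)

open scoped Pointwise in
/-- The characters in `Λ` are complete on every fundamental domain. -/
theorem IsDualLattice.ae_eq_zero_of_tile (hΛ : IsDualLattice ϖ χ Λ)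
    (hD : IsAddFundamentalDomain Λ S (haar K)) {g : K → ℂ} (hg : Integrable g (haar K))
    (hgS : ∀ x, x ∉ S → g x = 0)
    (h0 : ∀ y ∈ Λ, ∫ x, g x * (χ (y * x) : ℂ) ∂(haar K) = 0) :
    ∀ᵐ x ∂(haar K), g x = 0 := by
  have : Countable Λ := hΛ.countable.to_subtype
  -- Almost every point of `S` is the only point of its coset in `S`, so the vanishing coset sum
  -- reduces to `g x`.
  have hdis : ∀ᵐ x : K ∂(haar K), ∀ z : Λ, z ≠ 0 → ¬ (z +ᵥ x ∈ S ∧ x ∈ S) := by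
    refine ae_all_iff.2 fun z => ?_
    by_cases hz : z = 0
    · simp [hz]
    · have h1 : haar K (((-z : Λ) +ᵥ S) ∩ ((0 : Λ) +ᵥ S)) = 0 :=
        hD.aedisjoint (neg_ne_zero.2 hz)
      filter_upwards [measure_eq_zero_iff_ae_notMem.1 h1] with x hx _ hxS
      exact hx ⟨⟨z +ᵥ x, hxS.1, neg_vadd_vadd z x⟩, ⟨x, hxS.2, zero_vadd Λ x⟩⟩
  filter_upwards [hdis, hΛ.ae_tsum_eq_zero hg h0] with x h1 h2
  by_cases hx : x ∈ S
  · rw [tsum_eq_single 0 fun z hz => hgS _ fun hmem => h1 z hz ⟨hmem, hx⟩, zero_vadd] at h2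
    exact h2
  · exact hgS x hx

end Tiling

/-! ### Multiresolution analyses and the covering criterion. -/

section MRA

variable {hΛ : IsDualLattice ϖ χ Λ} {q : ℕ} {u : ℕ → K} {L : ℕ} {W : Fin L → Set K}
  {ψ : Fin L → L2 K}

theorem modulus_one : modulus (1 : Kˣ) = 1 := map_one (distribHaarChar K)

theorem IsDualLattice.coeFn_fourier_translate (hΛ : IsDualLattice ϖ χ Λ) (b : K) (f : L2 K) :
    hΛ.fourier (affine 1 b f) =ᵐ[haar K] fun ξ => conj (χ (b * ξ) : ℂ) * hΛ.fourier f ξ := by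
  filter_upwards [hΛ.coeFn_fourier_affine 1 b f] with ξ h
  rw [h]
  simp [dilationFactor, modulus_one]

/-- Inner products of translates as Fourier coefficients. -/
theorem IsDualLattice.inner_translate (hΛ : IsDualLattice ϖ χ Λ) (a b : K) (f g : L2 K) :
    inner ℂ (affine 1 a f) (affine 1 b g)
      = ∫ ξ, hΛ.fourier g ξ * conj (hΛ.fourier f ξ) * (χ ((a - b) * ξ) : ℂ) ∂(haar K) := by
  rw [← hΛ.fourier.inner_map_map, L2.inner_def]
  refine integral_congr_ae ?_
  filter_upwards [hΛ.coeFn_fourier_translate a f, hΛ.coeFn_fourier_translate b g] with ξ h1 h2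
  rw [h1, h2, RCLike.inner_apply, RingHom.map_mul, Complex.conj_conj, sub_mul, sub_eq_add_neg,
    AddChar.map_add_eq_mul, Circle.coe_mul, coe_char_neg]
  ring

namespace IsDualLattice.IsIndicatorMultiwavelet

/-- The covering condition in terms of the scaling set. -/
theorem covers_iff (h : hΛ.IsIndicatorMultiwavelet q u W ψ) :
    ((⋃ (m : Fin L) (j : ℕ) (_ : 1 ≤ j) (t : ℕ),
        (fun x : K => (ϖ : K) ^ j * x + u t) '' W m) =ᵐ[haar K] Set.univ) ↔
      ∀ᵐ x ∂(haar K), ∃ z : Λ, z +ᵥ x ∈ scalingSet ϖ W 0 := by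
  suffices hx : (⋃ (m : Fin L) (j : ℕ) (_ : 1 ≤ j) (t : ℕ),
      (fun x : K => (ϖ : K) ^ j * x + u t) '' W m) = {x | ∃ z : Λ, z +ᵥ x ∈ scalingSet ϖ W 0} by
    rw [hx, eventuallyEq_univ]; rfl
  ext x
  rw [Set.mem_ofPred_eq]
  simp only [Set.mem_iUnion, Set.mem_image]
  constructor
  · rintro ⟨l, j, hj, t, w, hw, rfl⟩
    refine ⟨⟨-u t, Λ.neg_mem (h.mem t)⟩, mem_scalingSet.2 ⟨l, -j, by omega, ?_⟩⟩
    change (ϖ : K) ^ (-(j : ℤ)) * (-u t + ((ϖ : K) ^ j * w + u t)) ∈ W l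
    have h0 : (ϖ : K) ^ j ≠ 0 := pow_ne_zero _ ϖ.ne_zero
    rw [zpow_neg, zpow_natCast, neg_add_cancel_comm_assoc, inv_mul_cancel_left₀ h0]
    exact hw
  · rintro ⟨z, hz⟩
    obtain ⟨l, i, hi, hw⟩ := mem_scalingSet.1 hz
    have hmem : -(z : K) ∈ Set.range u := by
      rw [← h.range]; exact Λ.neg_mem z.2
    obtain ⟨t, ht⟩ := hmem
    have hi' : (((-i).toNat : ℕ) : ℤ) = -i := Int.toNat_of_nonneg (by omega)
    refine ⟨l, (-i).toNat, by omega, t, _, hw, ?_⟩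
    change (ϖ : K) ^ (-i).toNat * ((ϖ : K) ^ i * (z + x)) + u t = x
    rw [← zpow_natCast, hi', zpow_neg, inv_mul_cancel_left₀ (zpow_ne_zero _ ϖ.ne_zero), ht]
    ring

/-- On the Fourier side the translates of `φ` are the characters of Λ restricted to a tile, where
they are orthonormal and complete. -/
theorem isOrthonormalBasisOf_scaling (h : hΛ.IsIndicatorMultiwavelet q u W ψ)
    (hD : IsAddFundamentalDomain Λ (scalingSet ϖ W 0) (haar K))
    {φ : L2 K} (hφ : hΛ.fourier φ =ᵐ[haar K] (scalingSet ϖ W 0).indicator 1) :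
    IsOrthonormalBasisOf (fun t : ℕ => affine 1 (u t) φ)
      (hΛ.bandlimited (scalingSet ϖ W 0)) := by
  classical
  have hm := measurableSet_scalingSet (ϖ := ϖ) h.measurableSet 0
  obtain ⟨S, hS⟩ : ∃ S, S = scalingSet ϖ W 0 := ⟨_, rfl⟩
  rw [← hS] at hm hφ hD ⊢
  constructor
  · rw [orthonormal_iff_ite]
    intro s t
    rw [hΛ.inner_translate]
    have h1 : ∫ ξ, hΛ.fourier φ ξ * conj (hΛ.fourier φ ξ) * (χ ((u s - u t) * ξ) : ℂ) ∂(haar K)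
        = ∫ ξ, S.indicator 1 ξ * (χ ((u s - u t) * ξ) : ℂ) ∂(haar K) := by
      refine integral_congr_ae ?_
      filter_upwards [hφ] with ξ hξ
      rw [hξ]
      by_cases hx : ξ ∈ S <;> simp [hx]
    rw [h1, hΛ.integral_indicator_mul_char_of_tile hm hD (Λ.sub_mem (h.mem s) (h.mem t))]
    simp only [sub_eq_zero, h.injective.eq_iff]
  · refine topologicalClosure_span_eq (hΛ.isClosed_bandlimited S) (fun t => ?_) fun f hf hort => ?_
    · rw [hΛ.mem_bandlimited hm]
      filter_upwards [hφ, hΛ.coeFn_fourier_translate (u t) φ] with ξ h1 h2 h3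
      rw [h2, h1, Set.indicator_of_notMem h3, mul_zero]
    · rw [hΛ.mem_bandlimited hm] at hf
      have hint : Integrable (fun ξ => hΛ.fourier f ξ * hΛ.fourier φ ξ) (haar K) :=
        (Lp.memLp (hΛ.fourier f)).integrable_mul (Lp.memLp (hΛ.fourier φ))
      have hg : (fun ξ => hΛ.fourier f ξ * hΛ.fourier φ ξ) =ᵐ[haar K] S.indicator (hΛ.fourier f) := by
        filter_upwards [hφ] with ξ hξ
        rw [hξ]
        by_cases hx : ξ ∈ S <;> simp [hx]
      have hz := hΛ.ae_eq_zero_of_tile hD (hint.congr hg)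
        (fun x hx => Set.indicator_of_notMem hx _) fun y hy => by
          obtain ⟨t, rfl⟩ : y ∈ Set.range u := by rw [← h.range]; exact hy
          rw [← hort t]
          have e : inner ℂ (affine 1 (u t) φ) f = inner ℂ (affine 1 (u t) φ) (affine 1 0 f) := by
            rw [affine_one_zero]
          rw [e, hΛ.inner_translate]
          refine integral_congr_ae ?_
          filter_upwards [hφ] with ξ hξ
          rw [hξ, sub_zero]
          by_cases hx : ξ ∈ S <;> simp [hx]
      have hz' : hΛ.fourier f = 0 := by
        refine Lp.ext ?_
        filter_upwards [hz, hf, Lp.coeFn_zero ℂ 2 (haar K)] with ξ h1 h2 h3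
        rw [h3, Pi.zero_apply]
        by_cases hx : ξ ∈ S
        · rwa [Set.indicator_of_mem hx] at h1
        · exact h2 hx
      simpa using hz'

theorem bandlimited_mono (h : hΛ.IsIndicatorMultiwavelet q u W ψ) {i j : ℤ} (hij : i ≤ j) :
    hΛ.bandlimited (scalingSet ϖ W i) ≤ hΛ.bandlimited (scalingSet ϖ W j) := by
  intro f hf
  rw [hΛ.mem_bandlimited (measurableSet_scalingSet h.measurableSet _)] at hf ⊢
  filter_upwards [hf] with ξ h1 h2
  exact h1 fun h3 => h2 (scalingSet_mono W hij h3)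

/-- If the translates of the scaling set cover `K`, then the spaces of functions whose Fourier
transforms vanish off its dilates form a multiresolution analysis. -/
theorem isMRA (h : hΛ.IsIndicatorMultiwavelet q u W ψ) (hL : L = q - 1)
    (hcov : ∀ᵐ x ∂(haar K), ∃ z : Λ, z +ᵥ x ∈ scalingSet ϖ W 0) :
    IsMRA ϖ u fun j => hΛ.bandlimited (scalingSet ϖ W j) where
  isClosed j := hΛ.isClosed_bandlimited _
  nested j := h.bandlimited_mono (by omega)
  dense := by
    have hdir : Directed (· ≤ ·) fun j : ℤ => hΛ.bandlimited (scalingSet ϖ W j) :=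
      (monotone_int_of_le_succ fun j => h.bandlimited_mono (by omega)).directed_le
    -- ψ_{j,t} lies in V_{j+1}, so the union of the V_j contains the whole wavelet basis.
    have hle : Submodule.span ℂ (Set.range fun i : Fin L × ℤ × ℕ =>
        waveletElement q ϖ u (ψ i.1) i.2.1 i.2.2) ≤
        ⨆ j : ℤ, hΛ.bandlimited (scalingSet ϖ W j) := by
      rw [Submodule.span_le]
      rintro _ ⟨⟨l, j, t⟩, rfl⟩
      exact Submodule.mem_iSup_of_mem (j + 1)
        (h.waveletElement_mem_bandlimited_scalingSet l (lt_add_one j) t)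
    have htop := Submodule.topologicalClosure_mono hle
    rw [h.multiwavelet.2, top_le_iff] at htop
    rw [← Submodule.coe_iSup_of_directed _ hdir, ← Submodule.topologicalClosure_coe, htop]
    rfl
  inter := by
    refine Set.eq_singleton_iff_unique_mem.2 ⟨Set.mem_iInter.2 fun j => Submodule.zero_mem _, ?_⟩
    intro f hf
    rw [Set.mem_iInter] at hf
    -- V_j is orthogonal to the wavelets of scale `j`; membership in every V_j gives orthogonality
    -- to all of them.
    exact eq_zero_of_inner_eq_zero h.multiwavelet.2 fun i =>
      h.inner_waveletElement_eq_zero i.1 le_rfl i.2.2 (hf i.2.1)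
  dilation j f := by
    rw [← scalingSet_add_one]
    exact (hΛ.affine_mem_bandlimited_iff (measurableSet_scalingSet h.measurableSet j) ϖ f).symm
  scaling := by
    have hm := measurableSet_scalingSet (ϖ := ϖ) h.measurableSet 0
    have h1 := h.haar_scalingSet_le hL
    have hD := hΛ.isAddFundamentalDomain_of_covers hm h1 hcov
    let g : L2 K := indicatorConstLp 2 hm (ne_top_of_le_ne_top ENNReal.one_ne_top h1) (1 : ℂ)
    have hg : hΛ.fourier (hΛ.fourier.symm g) =ᵐ[haar K] (scalingSet ϖ W 0).indicator 1 := by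
      rw [LinearIsometryEquiv.apply_symm_apply]
      exact indicatorConstLp_coeFn
    have hb := h.isOrthonormalBasisOf_scaling hD hg
    refine ⟨hΛ.fourier.symm g, ?_, hb⟩
    rw [hΛ.mem_bandlimited hm]
    filter_upwards [hg] with ξ h2 h3
    rw [h2, Set.indicator_of_notMem h3]

/-- For completeness at scale 0: wavelets of negative scale lie in V_0 and those of positive scale
are orthogonal to V_1, so a vector of the complement that is orthogonal to scale 0 is orthogonal to
the whole basis. -/
theorem comesFromMRA (h : hΛ.IsIndicatorMultiwavelet q u W ψ) :
    ComesFromMRA u ψ fun j => hΛ.bandlimited (scalingSet ϖ W j) := by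
  have hinj : Function.Injective fun i : Fin L × ℕ => ((i.1, 0, i.2) : Fin L × ℤ × ℕ) :=
    fun i j hij => Prod.ext (congrArg (fun x => x.1) hij) (congrArg (fun x => x.2.2) hij)
  have ho := h.orthonormal.comp _ hinj
  have he (i : Fin L × ℕ) : waveletElement q ϖ u (ψ i.1) 0 i.2 = affine 1 (u i.2) (ψ i.1) :=
    waveletElement_zero q ϖ u (ψ i.1) i.2
  have ho' : Orthonormal ℂ fun i : Fin L × ℕ => affine 1 (u i.2) (ψ i.1) := by
    rw [← funext he]; exact ho
  refine ⟨ho', topologicalClosure_span_eq ?_ (fun i => ?_) fun f hf hort => ?_⟩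
  · exact (hΛ.isClosed_bandlimited _).inter (Submodule.isClosed_orthogonal _)
  · rw [← he]
    refine ⟨h.waveletElement_mem_bandlimited_scalingSet i.1 (by norm_num) i.2, ?_⟩
    rw [SetLike.mem_coe, Submodule.mem_orthogonal']
    exact fun g hg => h.inner_waveletElement_eq_zero i.1 le_rfl i.2 hg
  · refine eq_zero_of_inner_eq_zero h.multiwavelet.2 ?_
    rintro ⟨l, j, t⟩
    rcases lt_trichotomy j 0 with hj | rfl | hj
    · exact (Submodule.mem_orthogonal _ _).1 hf.2 _
        (h.waveletElement_mem_bandlimited_scalingSet l hj t)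
    · have := hort (l, t)
      rwa [← he] at this
    · exact h.inner_waveletElement_eq_zero l (Int.add_one_le_of_lt hj) t hf.1

/-- Scale 0 is the hypothesis that `ψ l` is orthogonal to V_0; the dilation axiom transports it
upwards, since dilations only rescale inner products. -/
theorem inner_waveletElement_of_isMRA (h : hΛ.IsIndicatorMultiwavelet q u W ψ)
    {V : ℤ → Submodule ℂ (L2 K)} (hV : IsMRA ϖ u V) (hψ : ComesFromMRA u ψ V) (l : Fin L)
    (n t : ℕ) {f : L2 K} (hf : f ∈ V n) : inner ℂ (waveletElement q ϖ u (ψ l) n t) f = 0 := by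
  have hq : 0 < q := by have := h.one_lt; omega
  induction n generalizing f with
  | zero =>
    have h1 : affine 1 (u t) (ψ l) ∈ V 1 ⊓ (V 0)ᗮ := by
      rw [← hψ.2]
      exact Submodule.le_topologicalClosure _ (Submodule.subset_span ⟨(l, t), rfl⟩)
    rw [Nat.cast_zero, waveletElement_zero]
    exact (Submodule.mem_orthogonal' _ _).1 h1.2 f hf
  | succ n ih =>
    obtain ⟨c, hc⟩ := waveletElement_add_one q ϖ u (ψ l) n t hq
    have hff : affine ϖ⁻¹ 0 (affine ϖ 0 f) = f := by
      rw [affine_affine, mul_inv_cancel, mul_zero, zero_add, affine_one_zero]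
    rw [Nat.cast_add, Nat.cast_one] at hf ⊢
    have hf' : affine ϖ 0 f ∈ V n := by rwa [hV.dilation, hff]
    rw [hc, inner_smul_left, ← hff, inner_affine, ih hf', mul_zero, mul_zero]

/-- The base space of a multiresolution analysis inducing the multiwavelet consists of functions
whose Fourier transforms vanish off the scaling set. -/
theorem le_bandlimited (h : hΛ.IsIndicatorMultiwavelet q u W ψ)
    {V : ℤ → Submodule ℂ (L2 K)} (hV : IsMRA ϖ u V) (hψ : ComesFromMRA u ψ V) :
    V 0 ≤ hΛ.bandlimited (scalingSet ϖ W 0) := by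
  intro f hf
  have hmono : Monotone V := monotone_int_of_le_succ hV.nested
  -- V_0 ⊆ V_n for n ≥ 0, so `f` is orthogonal to all wavelets of nonnegative scale.
  have h1 := mem_topologicalClosure_span_image h.orthonormal h.multiwavelet.2
    {i | i.2.1 < 0} (f := f) (by
      rintro ⟨l, j, t⟩ hj
      have hj' : 0 ≤ j := not_lt.1 hj
      obtain ⟨n, rfl⟩ := Int.eq_ofNat_of_zero_le hj'
      exact h.inner_waveletElement_of_isMRA hV hψ l n t (hmono hj' hf))
  refine Submodule.topologicalClosure_minimal _ ?_ (hΛ.isClosed_bandlimited _) h1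
  rw [Submodule.span_le]
  rintro _ ⟨⟨l, j, t⟩, hj, rfl⟩
  exact h.waveletElement_mem_bandlimited_scalingSet l hj t

/-- Orthonormality of the translates of `φ` says that |φ̂|² and 1_𝔇 have the same integrals against
the characters of Λ, so their coset sums agree and equal 1. As φ̂ vanishes off the scaling set, a
coset missing that set would have sum 0. -/
theorem covers_of_isMRA (h : hΛ.IsIndicatorMultiwavelet q u W ψ)
    {V : ℤ → Submodule ℂ (L2 K)} (hV : IsMRA ϖ u V) (hψ : ComesFromMRA u ψ V) :
    ∀ᵐ x ∂(haar K), ∃ z : Λ, z +ᵥ x ∈ scalingSet ϖ W 0 := by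
  classical
  have : Countable Λ := hΛ.countable.to_subtype
  obtain ⟨φ, hφ, hφo, -⟩ := hV.scaling
  have hm := measurableSet_scalingSet (ϖ := ϖ) h.measurableSet 0
  have hS := (hΛ.mem_bandlimited hm φ).1 (h.le_bandlimited hV hψ hφ)
  obtain ⟨t₀, ht₀⟩ := h.exists_eq_zero
  obtain ⟨P, hP⟩ : ∃ P : K → ℂ, P = fun ξ => hΛ.fourier φ ξ * conj (hΛ.fourier φ ξ) := ⟨_, rfl⟩
  have hPi : Integrable P (haar K) := by
    refine (L2.integrable_inner (𝕜 := ℂ) (hΛ.fourier φ) (hΛ.fourier φ)).congr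
      (Eventually.of_forall fun ξ => ?_)
    simp only [hP, RCLike.inner_apply]
  have hDi : Integrable ((integerBall K).indicator (1 : K → ℂ)) (haar K) := by
    simpa using integrable_indicator_sub (0 : K)
  have h0 (y : K) (hy : y ∈ Λ) :
      ∫ x, (P x - (integerBall K).indicator 1 x) * (χ (y * x) : ℂ) ∂(haar K) = 0 := by
    have hθ : Continuous fun x => χ (y * x) := hΛ.continuous.comp (continuous_const_mul y)
    simp_rw [sub_mul]
    rw [integral_sub (integrable_mul_circle hPi hθ) (integrable_mul_circle hDi hθ),
      hΛ.integral_indicator_mul_char_of_mem hy]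
    obtain ⟨t, rfl⟩ : y ∈ Set.range u := by rw [← h.range]; exact hy
    have h1 := orthonormal_iff_ite.1 hφo t t₀
    rw [hΛ.inner_translate, ht₀, sub_zero] at h1
    have h2 : u t = 0 ↔ t = t₀ := by rw [← ht₀, h.injective.eq_iff]
    simp only [h2]
    rw [hP, h1, sub_self]
  have hsum := hΛ.ae_tsum_eq_zero (hPi.sub hDi) h0
  have hz : ∀ᵐ x ∂(haar K), ∀ z : Λ, (z : K) + x ∉ scalingSet ϖ W 0 → P ((z : K) + x) = 0 :=
    ae_all_iff.2 fun z => ae_comp_add (P := fun ξ => ξ ∉ scalingSet ϖ W 0 → P ξ = 0) z (by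
      filter_upwards [hS] with ξ h1 h2
      rw [hP]
      simp only [h1 h2, zero_mul])
  filter_upwards [hsum, hz] with x h1 h2
  by_contra! hcon
  obtain ⟨w, hw, huniq⟩ := hΛ.existsUnique_vadd_mem x
  have h3 (z : Λ) : (P - (integerBall K).indicator (1 : K → ℂ)) (z +ᵥ x)
      = -(integerBall K).indicator (1 : K → ℂ) (z +ᵥ x) := by
    have h4 : P (z +ᵥ x) = 0 := h2 z (hcon z)
    rw [Pi.sub_apply, h4, zero_sub]
  rw [tsum_congr h3, tsum_eq_single w] at h1
  · rw [Set.indicator_of_mem hw] at h1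
    simp at h1
  · intro z hzw
    rw [Set.indicator_of_notMem fun hmem => hzw (huniq z hmem), neg_zero]

end IsDualLattice.IsIndicatorMultiwavelet

end MRA

end LocalFieldWavelet

end

/-! ### The theorem. -/

open LocalFieldWavelet

theorem mainTheorem4 {K : Type*} [Field K] [ValuativeRel K] [TopologicalSpace K]
    [IsNonarchimedeanLocalField K] [MeasurableSpace K] [BorelSpace K]
    (p : ℕ) [Fact p.Prime] [CharP K p] (c : ℕ) (hq : Nat.card 𝓀[K] = p ^ c)
    (ϖ : Kˣ) (hϖ : IsUniformizer ϖ) (ε : Fin c → K) (hε : IsCoefficientBasis p c ε)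
    (χ : AddChar K Circle) (hχ : IsStandardCharacter p c ϖ ε χ)
    (W : Set K) (Wm : Fin (p ^ c - 1) → Set K)
    (hW : IsMultiwaveletSet (p ^ c) ϖ (shift p c ϖ ε) χ W Wm) :
    InducesMRA (p ^ c) ϖ (shift p c ϖ ε) χ Wm ↔
      (⋃ (m : Fin (p ^ c - 1)) (j : ℕ) (_ : 1 ≤ j) (t : ℕ),
        (fun x : K => (ϖ : K) ^ j * x + shift p c ϖ ε t) '' Wm m) =ᵐ[haar K] Set.univ := by
  obtain ⟨hinj, Λ, hrange, hΛ⟩ := exists_isDualLattice hq hϖ hε hχ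
  obtain ⟨-, hWm, ψ, hψW, hψ⟩ := hW
  -- Stated for arbitrary `ψ`, as the multiwavelet in `InducesMRA` is a priori not the given one;
  -- the scaling set depends only on `Wm`.
  have hmk {ψ : Fin (p ^ c - 1) → L2 K} (hψW : ∀ l, HasIndicatorTransform χ (ψ l) (Wm l))
      (hψ : IsMultiwavelet (p ^ c) ϖ (shift p c ϖ ε) ψ) :
      hΛ.IsIndicatorMultiwavelet (p ^ c) (shift p c ϖ ε) Wm ψ :=
    { one_lt := one_lt_of_card_residueField hq
      injective := hinj
      range := hrange
      measurableSet := hWm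
      fourier := fun l => by
        obtain ⟨g, hg, hfg⟩ := hψW l
        rw [hΛ.fourier_eq_of_isFourierTransform hfg]
        exact hg
      multiwavelet := hψ }
  have h := hmk hψW hψ
  rw [h.covers_iff]
  constructor
  · rintro ⟨ψ', hψW', hψ', V, hV, hVψ⟩
    exact (hmk hψW' hψ').covers_of_isMRA hV hVψ
  · intro hcov
    exact ⟨ψ, hψW, hψ, _, h.isMRA rfl hcov, h.comesFromMRA⟩
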